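/- Let $\tau$ be the substitution $1\mapsto 101$, $0\mapsto 1$ on words over $\{0,1\}$, and let $\mathbf s=(s_j)_{j\ge 0}=\lim_{j\to\infty}\tau^{j}(1)$ be its fixed point beginning with $1$. For $m\ge 0$ and $n\ge 1$ let $H_{m,n}=\det (s_{m+i+j})_{0\le i,j\le n-1}$. Put $f_{2j}=|\tau^{j}(1)|$ and $f_{2j+1}=|\tau^{j}(10)|$ for $j\ge 0$, where $|w|$ is the length of the word $w$; every $f_{2j}$ is odd and every $f_{2j+1}$ is even. Every integer $x\ge 0$ has a unique representation $x=\sum_{i\ge 0}a_i(x)f_i$ with $a_i(x)\in\{0,1\}$, almost all $a_i(x)$ equal to $0$, $a_i(x)a_{i+1}(x)=0$ for all $i\ge 0$, and $a_i(x)a_{i+2}(x)=0$ for all even $i\ge 0$. For $k\ge 0$ put $\Phi_k(x)=\sum_{i=0}^{2k+2}a_i(x)f_i$, and let $\gamma_1<\gamma_2<\cdots$ be the elements, in increasing order, of the infinite set $\{x\ge 0:\Phi_k(x)=f_{2k+3}/2\}$ (the $\gamma_i$ depend on $k$). Let $T_k=\bigcup_{i\ge 1}T_{k,i}$, where \[T_{k,i}=\{(m,n)\in\mathbb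 N^2: f_{2k+1}\le n<f_{2k+2},\ \gamma_i-f_{2k}<m+n\le\gamma_i\}.\] **Theorem.** Let $k\ge 0$. For all $(m,n)\in T_k$: 1. if $n=f_{2k+2}-1$, then $H_{m,n}=(-1)^{\frac{f_{2k}-1}{2}}\, f_{2k}$; 2. if $n=f_{2k+1}$, then $H_{m,n}=(-1)^{\Phi_k(m+n)-\frac{f_{2k+1}}{2}-1}\, f_{2k}$; 3. if $f_{2k+1}<n<f_{2k+2}-1$ and $m+n=\gamma_i-f_{2k}+1$ or $m+n=\gamma_i$ for some $i\ge 1$, then \[H_{m,n}=(-1)^{(f_{2k+2}-1-n)k}\,(-1)^{\frac{(f_{2k+2}-1-n)(f_{2k+2}-2-n)}{2}}\,(-1)^{\frac{f_{2k}-1}{2}}\, f_{2k};\] if $f_{2k+1}<n<f_{2k+2}-1$ and $m+n$ is of neither form for any $i\ge 1$, then $H_{m,n}=0$. -/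

import Mathlib

namespace TauHankel

/-! ### The substitution and its fixed point -/

/-- The substitution `1 ↦ 101`, `0 ↦ 1` on the letters `0, 1`. -/
def tau : Fin 2 → List (Fin 2)
  | 0 => [1]
  | 1 => [1, 0, 1]

/-- The substitution acting on finite words, letter by letter. -/
def tauWord (w : List (Fin 2)) : List (Fin 2) := w.flatMap tau

/-- The word obtained from `w` by applying the substitution `k` times. -/
def tauIter (k : ℕ) (w : List (Fin 2)) : List (Fin 2) := tauWord^[k] w

/-- `f (2 j)` is the length of the `j`-th image of `1`, and `f (2 j + 1)` that of the `j`-th image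
of `10`. -/
def f (n : ℕ) : ℕ :=
  if n % 2 = 0 then (tauIter (n / 2) [1]).length else (tauIter (n / 2) [1, 0]).length

/-- The fixed point of the substitution that starts with `1`: its `n`-th letter is the `n`-th
letter of the `n`-th image of `1`, a word with more than `n` letters. By `sSeq_spec` below all
images of `1` are prefixes of this sequence. -/
def sSeq (n : ℕ) : Fin 2 := (tauIter n [1]).getD n 0

theorem tauIter_append (k : ℕ) (u v : List (Fin 2)) :
    tauIter k (u ++ v) = tauIter k u ++ tauIter k v := by
  induction k generalizing u v with
  | zero => rfl
  | succ k ih =>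
    have h : tauWord (u ++ v) = tauWord u ++ tauWord v := by simp [tauWord]
    simp only [tauIter, Function.iterate_succ, Function.comp] at ih ⊢
    rw [h, ih]

theorem tauIter_succ_zero (k : ℕ) : tauIter (k + 1) [0] = tauIter k [1] := by
  simp [tauIter, tauWord, tau]

theorem tauIter_succ_one (k : ℕ) : tauIter (k + 1) [1] = tauIter k [1, 0, 1] := by
  simp [tauIter, tauWord, tau]

theorem f_even (j : ℕ) : f (2 * j) = (tauIter j [1]).length := by
  simp [f]

theorem f_odd (j : ℕ) : f (2 * j + 1) = (tauIter j [1, 0]).length := by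
  have h1 : (2 * j + 1) % 2 = 1 := by omega
  have h2 : (2 * j + 1) / 2 = j := by omega
  simp [f, h1, h2]

theorem f_zero : f 0 = 1 := by decide

theorem f_one : f 1 = 2 := by decide

theorem f_rec_even (j : ℕ) : f (2 * j + 2) = f (2 * j) + f (2 * j + 1) := by
  have h : 2 * j + 2 = 2 * (j + 1) := by ring
  rw [h, f_even, f_even, f_odd, tauIter_succ_one]
  have e : tauIter j [1, 0, 1] = tauIter j [1, 0] ++ tauIter j [1] := tauIter_append j [1, 0] [1]
  rw [e, List.length_append, add_comm]

theorem f_rec_odd (j : ℕ) : f (2 * j + 3) = f (2 * j) + f (2 * j + 2) := by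
  have h : 2 * j + 3 = 2 * (j + 1) + 1 := by ring
  have h' : 2 * j + 2 = 2 * (j + 1) := by ring
  rw [h, h', f_odd, f_even, f_even]
  have e : tauIter (j + 1) [1, 0] = tauIter (j + 1) [1] ++ tauIter (j + 1) [0] :=
    tauIter_append (j + 1) [1] [0]
  rw [e, List.length_append, tauIter_succ_zero, add_comm]

theorem f_pos (n : ℕ) : 0 < f n := by
  induction n using Nat.strong_induction_on with
  | _ n ih =>
    obtain ⟨j, rfl | rfl⟩ := Nat.even_or_odd' n
    · rcases j with _ | j
      · simp [f_zero]
      · have := f_rec_even j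
        have := ih (2 * j) (by omega)
        rw [show 2 * (j + 1) = 2 * j + 2 by ring]
        omega
    · rcases j with _ | j
      · simp [f_one]
      · have := f_rec_odd j
        have := ih (2 * j) (by omega)
        rw [show 2 * (j + 1) + 1 = 2 * j + 3 by ring]
        omega

theorem f_lt_succ (n : ℕ) : f n < f (n + 1) := by
  obtain ⟨j, rfl | rfl⟩ := Nat.even_or_odd' n
  · rcases j with _ | j
    · simp [f_zero, f_one]
    · have := f_rec_odd j
      have := f_pos (2 * j)
      rw [show 2 * (j + 1) = 2 * j + 2 by ring, show 2 * j + 2 + 1 = 2 * j + 3 by ring]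
      omega
  · have := f_rec_even j
    have := f_pos (2 * j)
    rw [show 2 * j + 1 + 1 = 2 * j + 2 by ring]
    omega

theorem f_strictMono : StrictMono f := strictMono_nat_of_lt_succ f_lt_succ

theorem tauIter_prefix (k : ℕ) : tauIter k [1] <+: tauIter (k + 1) [1] := by
  rw [tauIter_succ_one]
  exact ⟨tauIter k [0, 1], (tauIter_append k [1] [0, 1]).symm⟩

theorem tauIter_prefix_of_le {k l : ℕ} (h : k ≤ l) : tauIter k [1] <+: tauIter l [1] := by
  induction l, h using Nat.le_induction with
  | base => exact List.prefix_rfl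
  | succ l _ ih => exact ih.trans (tauIter_prefix l)

theorem lt_length_tauIter (n : ℕ) : n < (tauIter n [1]).length := by
  rw [← f_even]
  have := f_strictMono.le_apply (x := 2 * n)
  rcases n with _ | n
  · simp [f_zero]
  · omega

/-- Every image of `1` is a prefix of `sSeq`. -/
theorem sSeq_spec (k i : ℕ) (hi : i < (tauIter k [1]).length) : (tauIter k [1])[i] = sSeq i := by
  have hi' := lt_length_tauIter i
  have e : sSeq i = (tauIter i [1])[i] := by
    simp [sSeq, List.getD_eq_getElem?_getD, List.getElem?_eq_getElem hi']
  rw [e]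
  rcases le_total k i with h | h
  · exact (tauIter_prefix_of_le h).getElem hi
  · exact ((tauIter_prefix_of_le h).getElem hi').symm

/-! ### Hankel determinants -/

/-- The `n × n` Hankel determinant `det (s_{m+i+j})`, `0 ≤ i, j ≤ n - 1`, as an integer. -/
def hankelDet (m n : ℕ) : ℤ :=
  (Matrix.of fun i j : Fin n => ((sSeq (m + i + j) : ℕ) : ℤ)).det

/-! ### The `f`-representation of an integer -/

/-- `a` is the digit sequence of an `f`-representation of `n`: digits in `{0, 1}`, almost all zero,
no two adjacent digits equal to `1`, and `a i`, `a (i + 2)` not both `1` for `i` even. -/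
structure IsFRep (n : ℕ) (a : ℕ →₀ ℕ) : Prop where
  digit : ∀ i, a i = 0 ∨ a i = 1
  adj : ∀ i, a i * a (i + 1) = 0
  even_adj : ∀ i, Even i → a i * a (i + 2) = 0
  sum_eq : (a.sum fun i c => c * f i) = n

theorem sum_eq_sum_range (a : ℕ →₀ ℕ) (t : ℕ) (h : ∀ i, t ≤ i → a i = 0) :
    (a.sum fun i c => c * f i) = ∑ i ∈ Finset.range t, a i * f i := by
  apply Finsupp.sum_of_support_subset
  · intro i hi
    rw [Finset.mem_range]
    by_contra hc
    exact (Finsupp.mem_support_iff.mp hi) (h i (not_lt.mp hc))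
  · simp

theorem IsFRep.sum_range_lt {n : ℕ} {a : ℕ →₀ ℕ} (ha : IsFRep n a) (t : ℕ) :
    ∑ i ∈ Finset.range t, a i * f i < f t := by
  induction t using Nat.strong_induction_on with
  | _ t ih =>
    rcases t with _ | t
    · simp [f_zero]
    rw [Finset.sum_range_succ]
    rcases ha.digit t with h | h
    · have := ih t (by omega)
      have := f_lt_succ t
      rw [h]
      omega
    · rw [h]
      obtain ⟨j, rfl | rfl⟩ := Nat.even_or_odd' t
      · rcases j with _ | j
        · simp [f_zero, f_one]
        · have h1 : a (2 * j + 1) = 0 := by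
            have := ha.adj (2 * j + 1)
            rw [show 2 * j + 1 + 1 = 2 * (j + 1) by ring, h] at this
            simpa using this
          have h2 : a (2 * j) = 0 := by
            have := ha.even_adj (2 * j) (by simp)
            rw [show 2 * j + 2 = 2 * (j + 1) by ring, h] at this
            simpa using this
          have := ih (2 * j) (by omega)
          have := f_rec_odd j
          rw [show 2 * (j + 1) = 2 * j + 1 + 1 by ring, Finset.sum_range_succ,
            Finset.sum_range_succ, h1, h2]
          rw [show 2 * j + 1 + 1 = 2 * j + 2 by ring, show 2 * j + 2 + 1 = 2 * j + 3 by ring]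
          omega
      · have h2 : a (2 * j) = 0 := by
          have := ha.adj (2 * j)
          rw [h] at this
          simpa using this
        have := ih (2 * j) (by omega)
        have := f_rec_even j
        rw [Finset.sum_range_succ, h2]
        rw [show 2 * j + 1 + 1 = 2 * j + 2 by ring]
        omega

theorem IsFRep.unique {n : ℕ} {a b : ℕ →₀ ℕ} (ha : IsFRep n a) (hb : IsFRep n b) : a = b := by
  have key : ∀ t, ∑ i ∈ Finset.range t, a i * f i = ∑ i ∈ Finset.range t, b i * f i →
      ∀ i < t, a i = b i := by
    intro t
    induction t with
    | zero => intro _ i hi; omega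
    | succ t ih =>
      intro hs i hi
      rw [Finset.sum_range_succ, Finset.sum_range_succ] at hs
      have h1 := ha.sum_range_lt t
      have h2 := hb.sum_range_lt t
      have ht : a t = b t := by
        rcases ha.digit t with h | h <;> rcases hb.digit t with h' | h' <;> rw [h, h'] at hs ⊢ <;>
          omega
      rw [ht] at hs
      rcases Nat.lt_succ_iff_lt_or_eq.mp hi with h | rfl
      · exact ih (by omega) i h
      · exact ht
  obtain ⟨t, hat, hbt⟩ : ∃ t, (∀ i, t ≤ i → a i = 0) ∧ ∀ i, t ≤ i → b i = 0 := by
    refine ⟨(a.support ∪ b.support).sup id + 1, ?_, ?_⟩ <;> intro i hi <;> by_contra hc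
    · have := Finset.le_sup (f := id) (Finset.mem_union_left b.support
        (Finsupp.mem_support_iff.mpr hc))
      simp only [id] at this hi
      omega
    · have := Finset.le_sup (f := id) (Finset.mem_union_right a.support
        (Finsupp.mem_support_iff.mpr hc))
      simp only [id] at this hi
      omega
  have hs := ha.sum_eq.trans hb.sum_eq.symm
  rw [sum_eq_sum_range a t hat, sum_eq_sum_range b t hbt] at hs
  ext i
  rcases lt_or_ge i t with h | h
  · exact key t hs i h
  · rw [hat i h, hbt i h]

/-- Adding a digit `1` at position `t` to a representation whose digits at the positions `≥ u`
vanish. -/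
theorem IsFRep.add_single {n u t : ℕ} {a : ℕ →₀ ℕ} (ha : IsFRep n a) (hu : ∀ i, u ≤ i → a i = 0)
    (h1 : u < t ∨ t = 0 ∧ u = 0) (h2 : Even t → u + 1 < t ∨ t = 0) :
    IsFRep (n + f t) (a + Finsupp.single t 1) := by
  have hs : ∀ i, (Finsupp.single t 1 : ℕ →₀ ℕ) i = if t = i then 1 else 0 := by
    intro i
    exact Finsupp.single_apply
  refine ⟨fun i => ?_, fun i => ?_, fun i hi => ?_, ?_⟩
  · rw [Finsupp.add_apply, hs]
    rcases eq_or_ne t i with rfl | h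
    · right
      rw [hu t (by omega)]
      simp
    · simpa [h] using ha.digit i
  · simp only [Finsupp.add_apply, hs]
    have := ha.adj i
    by_cases e1 : t = i
    · rw [hu (i + 1) (by omega), if_neg (by omega : ¬ t = i + 1)]
      simp
    · by_cases e2 : t = i + 1
      · rw [hu i (by omega), if_neg e1]
        simp
      · simpa [e1, e2] using this
  · simp only [Finsupp.add_apply, hs]
    have := ha.even_adj i hi
    by_cases e1 : t = i
    · rw [hu (i + 2) (by omega), if_neg (by omega : ¬ t = i + 2)]
      simp
    · by_cases e2 : t = i + 2
      · have := h2 (by rw [e2]; exact hi.add (by decide))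
        rw [hu i (by omega), if_neg e1]
        simp
      · simpa [e1, e2] using this
  · rw [Finsupp.sum_add_index' (by simp) (by intros; ring), ha.sum_eq]
    simp

theorem isFRep_zero : IsFRep 0 0 := ⟨by simp, by simp, by simp, by simp⟩

theorem exists_isFRep_of_lt (t : ℕ) :
    ∀ n < f t, ∃ a : ℕ →₀ ℕ, IsFRep n a ∧ ∀ i, t ≤ i → a i = 0 := by
  induction t using Nat.strong_induction_on with
  | _ t ih =>
    intro n hn
    rcases t with _ | t
    · rw [f_zero] at hn
      obtain rfl : n = 0 := by omega
      exact ⟨0, isFRep_zero, by simp⟩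
    rcases lt_or_ge n (f t) with h | h
    · obtain ⟨a, ha, h0⟩ := ih t (by omega) n h
      exact ⟨a, ha, fun i hi => h0 i (by omega)⟩
    have key : ∀ u, u ≤ t → n - f t < f u → (u < t ∨ t = 0 ∧ u = 0) →
        (Even t → u + 1 < t ∨ t = 0) →
        ∃ a : ℕ →₀ ℕ, IsFRep n a ∧ ∀ i, t + 1 ≤ i → a i = 0 := by
      intro u hut hlt h1 h2
      obtain ⟨a, ha, h0⟩ := ih u (by omega) _ hlt
      have := ha.add_single h0 h1 h2
      rw [Nat.sub_add_cancel h] at this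
      refine ⟨_, this, fun i hi => ?_⟩
      rw [Finsupp.add_apply, h0 i (by omega), Finsupp.single_apply, if_neg (by omega), add_zero]
    obtain ⟨j, rfl | rfl⟩ := Nat.even_or_odd' t
    · rcases j with _ | j
      · apply key 0 (by omega) _ (by simp) (by simp)
        simp [f_zero, f_one] at hn h ⊢
        omega
      · have := f_rec_odd j
        rw [show 2 * (j + 1) = 2 * j + 2 by ring] at *
        exact key (2 * j) (by omega) (by rw [show 2 * j + 2 + 1 = 2 * j + 3 by ring] at hn; omega)
          (by omega) (by omega)
    · have := f_rec_even j
      refine key (2 * j) (by omega) (by rw [show 2 * j + 1 + 1 = 2 * j + 2 by ring] at hn; omega)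
        (by omega) ?_
      intro he
      exact absurd he (by simp)

/-- Every natural number has exactly one `f`-representation. -/
theorem existsUnique_isFRep (n : ℕ) : ∃! a : ℕ →₀ ℕ, IsFRep n a := by
  have hn : n < f (n + 1) := lt_of_lt_of_le (Nat.lt_succ_self n) f_strictMono.le_apply
  obtain ⟨a, ha, -⟩ := exists_isFRep_of_lt (n + 1) n hn
  exact ⟨a, ha, fun b hb => hb.unique ha⟩

/-- The digit `a_i(n)` of the `f`-representation of `n`. -/
noncomputable def digit (n i : ℕ) : ℕ := (existsUnique_isFRep n).choose i

/-- The truncated `f`-representation `Φ_k(n) = ∑_{i=0}^{2k+2} a_i(n) f_i`. -/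
noncomputable def Phi (k n : ℕ) : ℕ := ∑ i ∈ Finset.range (2 * k + 3), digit n i * f i

/-! ### The parallelograms `T_{k,i}` -/

/-- `E'_k`, the set of `x` with `Φ_k(x) = f_{2k+3} / 2` (here `f_{2k+3}` is even). -/
def E' (k : ℕ) : Set ℕ := {x | Phi k x = f (2 * k + 3) / 2}

theorem even_f_odd (j : ℕ) : Even (f (2 * j + 1)) := by
  have ho : ∀ j, Odd (f (2 * j)) ∧ Even (f (2 * j + 1)) := by
    intro j
    induction j with
    | zero => simp [f_zero, f_one]
    | succ j ih =>
      have e1 := f_rec_even j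
      have e2 := f_rec_odd j
      rw [show 2 * (j + 1) = 2 * j + 2 by ring, show 2 * j + 2 + 1 = 2 * j + 3 by ring]
      have h : Odd (f (2 * j + 2)) := e1 ▸ ih.1.add_even ih.2
      exact ⟨h, e2 ▸ ih.1.add_odd h⟩
  exact (ho j).2

/-- `E'_k` is infinite, so its increasing enumeration never ends. -/
theorem infinite_E' (k : ℕ) : (E' k).Infinite := by
  have hlt : f (2 * k + 3) / 2 < f (2 * k + 3) := Nat.div_lt_self (f_pos _) (by norm_num)
  obtain ⟨a, ha, h0⟩ := exists_isFRep_of_lt _ _ hlt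
  have hmem : ∀ t, f (2 * k + 3) / 2 + f (2 * k + 5 + t) ∈ E' k := by
    intro t
    have hr := ha.add_single (t := 2 * k + 5 + t) h0 (by omega) (by omega)
    have hd : ∀ i ∈ Finset.range (2 * k + 3),
        digit (f (2 * k + 3) / 2 + f (2 * k + 5 + t)) i * f i = a i * f i := by
      intro i hi
      have hi' := Finset.mem_range.mp hi
      have e := (existsUnique_isFRep (f (2 * k + 3) / 2 + f (2 * k + 5 + t))).choose_spec.1.unique hr
      rw [digit, e, Finsupp.add_apply, Finsupp.single_apply, if_neg (by omega), add_zero]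
    change Phi k _ = _
    rw [Phi, Finset.sum_congr rfl hd, ← sum_eq_sum_range a _ h0, ha.sum_eq]
  refine Set.infinite_of_injective_forall_mem (f := fun t => f (2 * k + 3) / 2 + f (2 * k + 5 + t))
    ?_ hmem
  intro x y hxy
  have := f_strictMono.injective (Nat.add_left_cancel hxy)
  omega

/-- `γ_i` for `i ≥ 1`: the `i`-th element of `E'_k` in increasing order. -/
noncomputable def gam (k i : ℕ) : ℕ := Nat.nth (fun x => x ∈ E' k) (i - 1)

/-- The parallelogram `T_{k,i}`: all `(m, n)` with `f_{2k+1} ≤ n < f_{2k+2}` and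
`γ_i - f_{2k} < n + m ≤ γ_i`. -/
def TPar (k i : ℕ) : Set (ℕ × ℕ) :=
  {p | f (2 * k + 1) ≤ p.2 ∧ p.2 < f (2 * k + 2) ∧
    (gam k i : ℤ) - f (2 * k) < p.2 + p.1 ∧ p.2 + p.1 ≤ gam k i}

/-- `T_k`, the union of the `T_{k,i}` over `i ≥ 1`. -/
def T (k : ℕ) : Set (ℕ × ℕ) := ⋃ i : ℕ, ⋃ _ : 1 ≤ i, TPar k i

/-- The sign `(-1)^z` for an integer exponent `z`, as an integer. -/
def sgn (z : ℤ) : ℤ := (z.negOnePow : ℤˣ)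

end TauHankel

/-! Write A and B for the `k`-th images of 1 and 0, and put w = f_{2k} = |A|, p = f_{2k+1} = |AB|.
The words AB and BA differ only by the interchange of their two middle letters (`near_commute`).
Hence, inside an occurrence of AABAA, the sequence has period p on a stretch of 2p + w - 2 places,
periodicity fails by ±1 just beyond both ends, and translation by w changes one period only in its
last two letters (`isStretch_of_factor`). The digits locate such occurrences: deleting a_0, ...,
a_{2k+2} from γ_i leaves the place of one (`exists_place`), so γ_i lies at a fixed distance from the
start of a stretch (`exists_stretch`).

A stretch determines the determinants. For order p the matrix X is Hankel on ℤ/p. With S_q the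
translation by q and J the all-ones matrix, (S_w - 1 + J) X is the antidiagonal matrix multiplied by
±(S_1 - 1 ± w J). Since w is prime to p, S_w - 1 + J and S_1 - 1 + J have the same nonzero
determinant; cancelling it leaves ±w (`hankel_period`). Moving the start by one place rotates the
rows and flips the sign.

For order p + t, subtracting from the t outer columns those one period away makes the matrix block
triangular, with antitriangular corners whose antidiagonals carry a defect of periodicity
(`hankel_of_periodic_stretch`). On the top and slanted edges the outer columns can be split between
left and right so that each antidiagonal entry is ±1; in the interior a split makes one antidiagonal
vanish. -/

namespace TauHankel

/-! ### Antitriangular and circulant determinants -/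

/-- The sign `(-1)^(n(n-1)/2)` of the reversal of `n` letters. -/
def revSign (n : ℕ) : ℤ := ∏ i ∈ Finset.range n, (-1) ^ i

theorem revSign_succ (n : ℕ) : revSign (n + 1) = revSign n * (-1) ^ n := by
  simp [revSign, Finset.prod_range_succ]

theorem revSign_two_mul (n : ℕ) : revSign (2 * n) = (-1) ^ n := by
  induction n with
  | zero => simp [revSign]
  | succ n ih =>
    rw [show 2 * (n + 1) = 2 * n + 1 + 1 by ring, revSign_succ, revSign_succ, ih, pow_succ,
      pow_mul, pow_succ, pow_succ (-1 : ℤ) n]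
    simp

theorem revSign_two_mul_add_one (n : ℕ) : revSign (2 * n + 1) = (-1) ^ n := by
  rw [revSign_succ, revSign_two_mul, pow_mul]
  simp

/-- The determinant of a matrix that vanishes above the antidiagonal. -/
theorem det_antitriangular_lower {n : ℕ} (d : ℤ) (M : Matrix (Fin n) (Fin n) ℤ)
    (h0 : ∀ i j : Fin n, (i : ℕ) + j + 1 < n → M i j = 0)
    (h1 : ∀ i j : Fin n, (i : ℕ) + j + 1 = n → M i j = d) :
    M.det = revSign n * d ^ n := by
  induction n with
  | zero => simp [revSign]
  | succ n ih =>
    rw [Matrix.det_succ_row M 0, Finset.sum_eq_single (Fin.last n)]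
    · rw [ih, h1 0 (Fin.last n) (by simp), revSign_succ]
      · simp
        ring
      · intro i j hij
        simp only [Matrix.submatrix_apply]
        apply h0
        simp
        omega
      · intro i j hij
        simp only [Matrix.submatrix_apply]
        apply h1
        simp
        omega
    · intro j _ hj
      have : (j : ℕ) < n := by
        have := Fin.val_lt_last hj
        simpa using this
      rw [h0 0 j (by simp; omega)]
      simp
    · simp

/-- The determinant of a matrix that vanishes below the antidiagonal. -/
theorem det_antitriangular_upper {n : ℕ} (d : ℤ) (M : Matrix (Fin n) (Fin n) ℤ)
    (h0 : ∀ i j : Fin n, n < (i : ℕ) + j + 1 → M i j = 0)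
    (h1 : ∀ i j : Fin n, (i : ℕ) + j + 1 = n → M i j = d) :
    M.det = revSign n * d ^ n := by
  induction n with
  | zero => simp [revSign]
  | succ n ih =>
    rw [Matrix.det_succ_row M (Fin.last n), Finset.sum_eq_single 0]
    · rw [ih, h1 (Fin.last n) 0 (by simp), revSign_succ]
      · simp
        ring
      · intro i j hij
        simp only [Matrix.submatrix_apply]
        apply h0
        simp
        omega
      · intro i j hij
        simp only [Matrix.submatrix_apply]
        apply h1
        simp
        omega
    · intro j _ hj
      have : 0 < (j : ℕ) := Nat.pos_of_ne_zero fun h => hj (Fin.ext h)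
      rw [h0 (Fin.last n) j (by simp; omega)]
      simp
    · simp

section Circulant

variable {p : ℕ} [NeZero p]

/-- The permutation matrix of the translation by `c`. -/
def shiftMat (p : ℕ) (c : ZMod p) : Matrix (ZMod p) (ZMod p) ℚ :=
  Matrix.of fun i j => if j = i + c then 1 else 0

/-- The matrix all of whose entries are `1`. -/
def allOnes (p : ℕ) : Matrix (ZMod p) (ZMod p) ℚ := Matrix.of fun _ _ => 1

theorem shiftMat_mul_apply (c : ZMod p) (M : Matrix (ZMod p) (ZMod p) ℚ) (i j : ZMod p) :
    (shiftMat p c * M) i j = M (i + c) j := by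
  simp [shiftMat, Matrix.mul_apply]

theorem allOnes_mul_apply (M : Matrix (ZMod p) (ZMod p) ℚ) (i j : ZMod p) :
    (allOnes p * M) i j = ∑ l, M l j := by
  simp [allOnes, Matrix.mul_apply]

/-- Multiplication by the unit `q` permutes `ZMod p`, conjugates translation by `q` to translation
by one, and fixes the all-ones matrix. -/
theorem det_shiftMat_eq_of_coprime {q : ℕ} (hq : q.Coprime p) :
    (shiftMat p q - 1 + allOnes p).det = (shiftMat p 1 - 1 + allOnes p).det := by
  rw [← Matrix.det_submatrix_equiv_self (Units.mulLeft (ZMod.unitOfCoprime q hq))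
    (shiftMat p q - 1 + allOnes p)]
  congr 1
  ext i j
  have hu : IsUnit ((q : ℕ) : ZMod p) := (ZMod.unitOfCoprime q hq).isUnit
  have e : (q : ZMod p) * j = q * i + q ↔ j = i + 1 := by
    rw [← mul_add_one]
    exact hu.mul_right_inj
  have e' : (q : ZMod p) * i = q * j ↔ i = j := hu.mul_right_inj
  simp [shiftMat, allOnes, Matrix.one_apply, e, e']

/-- Summing the coordinates of the equation for a kernel vector shows that its sum is 0. It is then
invariant under translation, so constant, so 0. The value itself is never needed: this determinant
cancels. -/
theorem det_shiftMat_ne_zero : (shiftMat p 1 - 1 + allOnes p).det ≠ 0 := by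
  intro h
  obtain ⟨v, hv, h0⟩ := Matrix.exists_mulVec_eq_zero_iff.mpr h
  have key : ∀ i, v (i + 1) - v i + ∑ l, v l = 0 := by
    intro i
    rw [Matrix.add_mulVec, Matrix.sub_mulVec, Matrix.one_mulVec] at h0
    have := congrFun h0 i
    simpa [Matrix.mulVec, dotProduct, shiftMat, allOnes] using this
  have hs : ∑ l, v l = 0 := by
    have h1 : ∑ i, (v (i + 1) - v i + ∑ l, v l) = 0 := Finset.sum_eq_zero fun i _ => key i
    rw [Finset.sum_add_distrib, Finset.sum_sub_distrib,
      show ∑ i, v (i + 1) = ∑ i, v i from Equiv.sum_comp (Equiv.addRight (1 : ZMod p)) v] at h1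
    simpa [NeZero.ne p] using h1
  have hc : ∀ n : ℕ, v (n : ZMod p) = v 0 := by
    intro n
    induction n with
    | zero => simp
    | succ n ih =>
      have := key n
      rw [hs] at this
      push_cast
      linarith
  have hc' : ∀ i, v i = v 0 := by
    intro i
    rw [← ZMod.natCast_zmod_val i]
    exact hc _
  apply hv
  ext i
  rw [hc' i]
  rw [Finset.sum_congr rfl fun i _ => hc' i] at hs
  simpa [NeZero.ne p] using hs

/-- With S the translation and J the all-ones matrix, (S - 1) J = 0 and J² = p J, so the left-hand
matrix is (S - 1 + J)(1 + ((t - 1)/p) J). The second factor is a rank-one perturbation of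
determinant t. -/
theorem det_shiftMat_add_smul (t : ℚ) :
    (shiftMat p 1 - 1 + t • allOnes p).det = t * (shiftMat p 1 - 1 + allOnes p).det := by
  have hp : (p : ℚ) ≠ 0 := by exact_mod_cast NeZero.ne p
  have hJ : (1 + ((t - 1) / p) • allOnes p).det = t := by
    have := Matrix.det_one_add_replicateCol_mul_replicateRow (ι := Unit)
      (fun _ : ZMod p => (t - 1) / p) (fun _ : ZMod p => (1 : ℚ))
    have e : Matrix.replicateCol Unit (fun _ : ZMod p => (t - 1) / (p : ℚ)) *
        Matrix.replicateRow Unit (fun _ : ZMod p => (1 : ℚ)) = ((t - 1) / p) • allOnes p := by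
      ext i j
      simp [Matrix.mul_apply, allOnes]
    rw [e] at this
    rw [this]
    simp [dotProduct, ZMod.card]
    field_simp
    ring
  have hmul : (shiftMat p 1 - 1 + allOnes p) * (1 + ((t - 1) / p) • allOnes p) =
      shiftMat p 1 - 1 + t • allOnes p := by
    rw [add_mul, sub_mul]
    ext i j
    rw [Matrix.add_apply, Matrix.sub_apply, shiftMat_mul_apply, allOnes_mul_apply, one_mul]
    simp only [allOnes, shiftMat, Matrix.add_apply, Matrix.sub_apply, Matrix.smul_apply,
      Matrix.of_apply, Matrix.one_apply, Finset.sum_add_distrib, smul_eq_mul, Finset.sum_const,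
      Finset.card_univ, ZMod.card, nsmul_eq_mul, Finset.sum_ite_eq', Finset.mem_univ, if_true,
      eq_comm (a := j)]
    field_simp
    ring
  rw [← hmul, Matrix.det_mul, hJ, mul_comm]

/-- The determinant of a cyclic Hankel matrix on `ZMod p`, for a vector of sum `w` that changes only
at two adjacent places under a translation by `q`. -/
theorem det_cyclic_hankel (hp : Even p) (x : ZMod p → ℚ) {q : ℕ} (hq : q.Coprime p) (w : ℚ)
    (hw : ∑ i, x i = w) (e : ℚ) (he : e * e = 1)
    (hx : ∀ i, x (i + q) - x i = e * ((if i + 1 = -1 then 1 else 0) - (if i = -1 then 1 else 0))) :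
    (Matrix.of fun i j : ZMod p => x (i + j)).det =
      e * w * (Matrix.of fun i j : ZMod p => if i + j = -1 then (1 : ℚ) else 0).det := by
  -- Both sides have the entry x(i+j+q) - x(i+j) + w at (i, j). The scalar `e` is taken out in
  -- front, so the coefficient of the all-ones matrix has to be `e * w`, as e² = 1.
  have hmul : (shiftMat p q - 1 + allOnes p) * (Matrix.of fun i j : ZMod p => x (i + j)) =
      (e • (shiftMat p 1 - 1 + (e * w) • allOnes p)) *
        (Matrix.of fun i j : ZMod p => if i + j = -1 then (1 : ℚ) else 0) := by
    rw [Matrix.smul_mul, add_mul, sub_mul, add_mul, sub_mul, Matrix.smul_mul]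
    ext i j
    simp only [Matrix.add_apply, Matrix.sub_apply, shiftMat_mul_apply, allOnes_mul_apply, one_mul,
      Matrix.smul_apply, Matrix.of_apply, smul_eq_mul]
    have h1 : ∑ l, x (l + j) = w := by rw [← hw]; exact Equiv.sum_comp (Equiv.addRight j) x
    have h2 : ∑ l : ZMod p, (if l + j = -1 then (1 : ℚ) else 0) = 1 := by
      refine (Equiv.sum_comp (Equiv.addRight j) (fun l => if l = -1 then (1 : ℚ) else 0)).trans ?_
      simp
    have h3 := hx (i + j)
    rw [h1, h2, show i + q + j = i + j + q by ring, h3, show i + 1 + j = i + j + 1 by ring]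
    linear_combination (-w) * he
  have hdet := congrArg Matrix.det hmul
  rw [Matrix.det_mul, Matrix.det_mul, Matrix.det_smul, det_shiftMat_eq_of_coprime hq,
    det_shiftMat_add_smul, ZMod.card] at hdet
  have hep : e ^ p = 1 := by
    obtain ⟨r, rfl⟩ := hp
    rw [← two_mul, pow_mul, pow_two, he, one_pow]
  rw [hep] at hdet
  apply mul_left_cancel₀ (det_shiftMat_ne_zero (p := p))
  rw [hdet]
  ring

end Circulant

/-! ### Hankel determinants along a nearly periodic stretch -/

/-- The `n × n` Hankel determinant of `u` that starts at `m`. -/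
def hankel (u : ℕ → ℤ) (m n : ℕ) : ℤ := (Matrix.of fun i j : Fin n => u (m + i + j)).det

/-- The Hankel determinant over a full even period changes its sign when the start moves by one. -/
theorem hankel_succ_of_periodic (u : ℕ → ℤ) (m p : ℕ) (hp : Even p) (hp0 : 0 < p)
    (h : ∀ i < p, u (m + i + p) = u (m + i)) : hankel u (m + 1) p = -hankel u m p := by
  obtain ⟨p, rfl⟩ : ∃ p', p = p' + 1 := ⟨p - 1, by omega⟩
  -- By periodicity, the moved window is the old one with its rows rotated, and a cycle of even
  -- length is odd.
  have hs := Matrix.det_permute (finRotate (p + 1)) (Matrix.of fun i j : Fin (p + 1) => u (m + i + j))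
  have hodd : Odd p := by
    rw [Nat.even_add_one, Nat.not_even_iff_odd] at hp
    exact hp
  rw [sign_finRotate, Nat.add_sub_cancel, hodd.neg_one_pow] at hs
  have e : (Matrix.of fun i j : Fin (p + 1) => u (m + 1 + i + j)) =
      (Matrix.of fun i j : Fin (p + 1) => u (m + i + j)).submatrix (finRotate (p + 1)) id := by
    ext i j
    simp only [Matrix.of_apply, Matrix.submatrix_apply, id]
    rcases eq_or_ne i (Fin.last p) with rfl | hi
    · rw [finRotate_last, Fin.val_last, Fin.val_zero, add_zero, ← h j j.2]
      congr 1
      ring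
    · rw [coe_finRotate_of_ne_last hi]
      congr 1
      ring
  rw [hankel, e, hs, hankel]
  simp

/-- Over one period, the Hankel determinant of a word of sum `w` whose translate by `w` differs
from it only by the interchange of its last two letters. -/
theorem hankel_period (u : ℕ → ℤ) (a p w : ℕ) (hp : Even p) (hw : w < p) (hw0 : 0 < w)
    (hcop : w.Coprime p) (hper : ∀ i < p + w - 2, u (a + i + p) = u (a + i))
    (e : ℤ) (he : e * e = 1)
    (hshift : ∀ i < p, u (a + i + w) - u (a + i) =
      e * ((if i + 2 = p then 1 else 0) - (if i + 1 = p then 1 else 0)))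
    (hsum : ∑ i ∈ Finset.range p, u (a + i) = w) :
    hankel u a p = e * w * revSign p := by
  have : NeZero p := ⟨by omega⟩
  obtain ⟨p', rfl⟩ : ∃ p', p = p' + 1 := ⟨p - 1, by omega⟩
  -- Wrapping the first period onto `ZMod` is harmless: the matrix and the translate by `w` only use
  -- indices at most 2p - 2, where `u` is still periodic.
  set x : ZMod (p' + 1) → ℚ := fun z => (u (a + z.val) : ℚ) with hx
  have hmod : ∀ i < 2 * (p' + 1) - 1, u (a + i % (p' + 1)) = u (a + i) := by
    intro i hi
    rcases lt_or_ge i (p' + 1) with h | h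
    · rw [Nat.mod_eq_of_lt h]
    · rw [Nat.mod_eq_sub_mod h, Nat.mod_eq_of_lt (by omega), ← hper _ (by omega)]
      congr 1
      omega
  have hneg : ∀ i : ZMod (p' + 1), i = -1 ↔ i.val + 1 = p' + 1 := by
    intro i
    rw [← ZMod.val_injective (p' + 1) |>.eq_iff, ZMod.val_neg_one]
    omega
  have hneg2 : ∀ i : ZMod (p' + 1), i + 1 = -1 ↔ i.val + 2 = p' + 1 := by
    intro i
    have hi := ZMod.val_lt i
    rw [hneg, ZMod.val_add, ZMod.val_one'' (by omega)]
    rcases Nat.lt_or_ge (i.val + 1) (p' + 1) with h | h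
    · rw [Nat.mod_eq_of_lt h]
    · rw [show i.val + 1 = p' + 1 by omega, Nat.mod_self]
      omega
  have h := det_cyclic_hankel (p := p' + 1) hp x hcop w
    (by
      have : ∑ i : ZMod (p' + 1), x i = ((∑ i ∈ Finset.range (p' + 1), u (a + i) : ℤ) : ℚ) := by
        push_cast
        rw [Finset.sum_range]
        rfl
      rw [this, hsum]
      simp) (e : ℚ) (by exact_mod_cast he)
    (by
      intro i
      have hi := ZMod.val_lt i
      have h1 := hshift i.val hi
      have e1 : (i + (w : ZMod (p' + 1))).val = (i.val + w) % (p' + 1) := by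
        rw [ZMod.val_add, ZMod.val_natCast_of_lt hw]
      simp only [hx]
      rw [e1, hmod _ (by omega), ← add_assoc, if_congr (hneg2 i) rfl rfl, if_congr (hneg i) rfl rfl]
      exact_mod_cast h1)
  have hK : (Matrix.of fun i j : ZMod (p' + 1) => if i + j = -1 then (1 : ℚ) else 0).det =
      ((revSign (p' + 1) : ℤ) : ℚ) := by
    have h2 := det_antitriangular_lower (n := p' + 1) 1
      (Matrix.of fun i j : Fin (p' + 1) => if (i : ℕ) + j + 1 = p' + 1 then (1 : ℤ) else 0)
      (by intro i j hij; simp; omega) (by intro i j hij; simp; omega)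
    rw [one_pow, mul_one] at h2
    rw [← h2, Int.cast_det]
    congr 1
    ext i j
    have hi := ZMod.val_lt i
    have hj := ZMod.val_lt j
    have e2 : i + j = -1 ↔ i.val + j.val + 1 = p' + 1 := by
      rw [hneg, ZMod.val_add]
      rcases Nat.lt_or_ge (i.val + j.val) (p' + 1) with h | h
      · rw [Nat.mod_eq_of_lt h]
      · rw [Nat.mod_eq_sub_mod h, Nat.mod_eq_of_lt (by omega)]
        omega
    change (if i + j = -1 then (1 : ℚ) else 0) =
      ((if i.val + j.val + 1 = p' + 1 then (1 : ℤ) else 0 : ℤ) : ℚ)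
    rw [if_congr e2 rfl rfl]
    push_cast
    rfl
  have hM : ((hankel u a (p' + 1) : ℤ) : ℚ) =
      (Matrix.of fun i j : ZMod (p' + 1) => x (i + j)).det := by
    rw [hankel, Int.cast_det]
    congr 1
    ext i j
    have hi := Fin.is_lt i
    have hj := Fin.is_lt j
    have e1 := ZMod.val_add (n := p' + 1) i j
    have e2 : u (a + i + j) = u (a + ((i : ℕ) + j) % (p' + 1)) := by
      rw [hmod _ (by omega), add_assoc]
    exact (congrArg (Int.cast : ℤ → ℚ) e2).trans (congrArg (fun z => ((u (a + z) : ℤ) : ℚ)) e1.symm)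
  rw [hK, ← hM] at h
  exact_mod_cast h

/-- The order `left, middle, right` on the rows of a matrix with `l + p + r` rows. -/
def blockEquiv (l p r : ℕ) : (Fin l ⊕ Fin r) ⊕ Fin p ≃ Fin (l + p + r) :=
  (((Equiv.sumAssoc _ _ _).trans ((Equiv.refl _).sumCongr (Equiv.sumComm _ _))).trans
    (Equiv.sumAssoc _ _ _).symm).trans ((finSumFinEquiv.sumCongr (Equiv.refl _)).trans finSumFinEquiv)

theorem blockEquiv_left (l p r : ℕ) (i : Fin l) :
    ((blockEquiv l p r (Sum.inl (Sum.inl i)) : Fin (l + p + r)) : ℕ) = i := by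
  simp [blockEquiv]

theorem blockEquiv_right (l p r : ℕ) (i : Fin r) :
    ((blockEquiv l p r (Sum.inl (Sum.inr i)) : Fin (l + p + r)) : ℕ) = l + p + i := by
  simp [blockEquiv]

theorem blockEquiv_middle (l p r : ℕ) (i : Fin p) :
    ((blockEquiv l p r (Sum.inr i) : Fin (l + p + r)) : ℕ) = l + i := by
  simp [blockEquiv]

/-- A Hankel determinant of order `p + (l + r)` reduces to one of order `p` when the sequence has
period `p` on the middle part of the window. -/
theorem hankel_of_periodic_stretch (u : ℕ → ℤ) (m l p r : ℕ) (hl : l ≤ p) (hr : r ≤ p)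
    (h0 : ∀ i, m + l ≤ i → i + 1 < m + l + p + l + r → u (i + p) = u i) :
    hankel u m (l + p + r) = revSign l * (u (m + l - 1) - u (m + l - 1 + p)) ^ l *
      (revSign r * (u (m + l + p + l + r - 1 + p) - u (m + l + p + l + r - 1)) ^ r) *
      hankel u (m + 2 * l) p := by
  set H : Matrix ((Fin l ⊕ Fin r) ⊕ Fin p) ((Fin l ⊕ Fin r) ⊕ Fin p) ℤ :=
    Matrix.of fun i j => u (m + blockEquiv l p r i + blockEquiv l p r j) with hH
  have hdet : hankel u m (l + p + r) = H.det := by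
    rw [hankel, ← Matrix.det_submatrix_equiv_self (blockEquiv l p r)]
    rfl
  -- `N` selects the middle column one period away from an outer one: a left column `j` is paired
  -- with `j + p`, hence middle index `j + p - l`, and a right column `l + p + j` with `l + j`,
  -- hence middle index `j`.
  let N : Matrix (Fin p) (Fin l ⊕ Fin r) ℤ := Matrix.of fun k s =>
    Sum.elim (fun j : Fin l => if k = ⟨j + p - l, by omega⟩ then 1 else 0)
      (fun j : Fin r => if k = ⟨j, by omega⟩ then 1 else 0) s
  have hN : ∀ (c : ℕ) (s : Fin l ⊕ Fin r),
      ∑ k : Fin p, u (c + (l + k)) * N k s =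
        Sum.elim (fun j : Fin l => u (c + j + p)) (fun j : Fin r => u (c + l + j)) s := by
    rintro c (j | j)
    · simp only [N, Matrix.of_apply, Sum.elim_inl, mul_ite, mul_one, mul_zero, Finset.sum_ite_eq',
        Finset.mem_univ, if_true]
      congr 1
      omega
    · simp only [N, Matrix.of_apply, Sum.elim_inr, mul_ite, mul_one, mul_zero, Finset.sum_ite_eq',
        Finset.mem_univ, if_true]
      congr 1
      omega
  have h12 : ∀ i s, (H.toBlocks₁₂ * N) i s =
      Sum.elim (fun j : Fin l => u (m + blockEquiv l p r (Sum.inl i) + j + p))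
        (fun j : Fin r => u (m + blockEquiv l p r (Sum.inl i) + l + j)) s := by
    intro i s
    rw [← hN, Matrix.mul_apply]
    simp [H, Matrix.toBlocks₁₂, blockEquiv_middle]
  have h22 : ∀ i s, (H.toBlocks₂₂ * N) i s =
      Sum.elim (fun j : Fin l => u (m + (l + i) + j + p))
        (fun j : Fin r => u (m + (l + i) + l + j)) s := by
    intro i s
    rw [← hN, Matrix.mul_apply]
    simp [H, Matrix.toBlocks₂₂, blockEquiv_middle]
  have h21 : H.toBlocks₂₁ - H.toBlocks₂₂ * N = 0 := by
    ext i s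
    rw [Matrix.sub_apply, h22]
    rcases s with j | j
    · simp only [H, Matrix.toBlocks₂₁, Matrix.of_apply, blockEquiv_middle, blockEquiv_left,
        Sum.elim_inl]
      rw [h0 (m + (l + i) + j) (by omega) (by omega)]
      simp
    · simp only [H, Matrix.toBlocks₂₁, Matrix.of_apply, blockEquiv_middle, blockEquiv_right,
        Sum.elim_inr]
      rw [← h0 (m + (l + i) + l + j) (by omega) (by omega)]
      rw [show m + (l + i : ℕ) + (l + p + j) = m + (l + i) + l + j + p by ring]
      simp
  have hmul : H * Matrix.fromBlocks 1 0 (-N) 1 =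
      Matrix.fromBlocks (H.toBlocks₁₁ - H.toBlocks₁₂ * N) H.toBlocks₁₂ 0 H.toBlocks₂₂ := by
    conv_lhs => rw [← Matrix.fromBlocks_toBlocks H]
    rw [Matrix.fromBlocks_multiply, ← h21]
    simp [sub_eq_add_neg]
  -- The entries are now defects of periodicity. Left rows meet right columns only inside the
  -- periodic range, so that block is 0 and the lower left one does not affect the determinant.
  have hdiag : H.toBlocks₁₁ - H.toBlocks₁₂ * N = Matrix.fromBlocks
      (Matrix.of fun i j : Fin l => u (m + i + j) - u (m + i + j + p)) 0
      (Matrix.of fun (i : Fin r) (j : Fin l) =>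
        u (m + (l + p + i) + j) - u (m + (l + p + i) + j + p))
      (Matrix.of fun i j : Fin r =>
        u (m + (l + p + i) + l + j + p) - u (m + (l + p + i) + l + j)) := by
    ext i s
    rw [Matrix.sub_apply, h12]
    rcases i with i | i <;> rcases s with j | j
    · simp [H, Matrix.toBlocks₁₁, blockEquiv_left]
    · simp only [H, Matrix.toBlocks₁₁, Matrix.of_apply, blockEquiv_left, blockEquiv_right,
        Sum.elim_inr, Matrix.fromBlocks_apply₁₂, Matrix.zero_apply]
      rw [← h0 (m + i + l + j) (by omega) (by omega),
        show m + (i : ℕ) + (l + p + j) = m + i + l + j + p by ring]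
      simp
    · simp [H, Matrix.toBlocks₁₁, blockEquiv_left, blockEquiv_right]
    · simp only [H, Matrix.toBlocks₁₁, Matrix.of_apply, blockEquiv_right,
        Sum.elim_inr, Matrix.fromBlocks_apply₂₂]
      congr 2
      ring
  have hL := det_antitriangular_upper (u (m + l - 1) - u (m + l - 1 + p))
    (Matrix.of fun i j : Fin l => u (m + i + j) - u (m + i + j + p))
    (by
      intro i j hij
      simp only [Matrix.of_apply]
      rw [h0 (m + i + j) (by omega) (by omega), sub_self])
    (by
      intro i j hij
      simp only [Matrix.of_apply]
      rw [show m + (i : ℕ) + j = m + l - 1 by omega])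
  have hR := det_antitriangular_lower
    (u (m + l + p + l + r - 1 + p) - u (m + l + p + l + r - 1))
    (Matrix.of fun i j : Fin r => u (m + (l + p + i) + l + j + p) - u (m + (l + p + i) + l + j))
    (by
      intro i j hij
      simp only [Matrix.of_apply]
      rw [h0 (m + (l + p + i) + l + j) (by omega) (by omega), sub_self])
    (by
      intro i j hij
      simp only [Matrix.of_apply]
      rw [show m + (l + p + i : ℕ) + l + j = m + l + p + l + r - 1 by omega])
  have hM : H.toBlocks₂₂.det = hankel u (m + 2 * l) p := by
    rw [hankel]
    congr 1
    ext i j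
    simp only [H, Matrix.toBlocks₂₂, Matrix.of_apply, blockEquiv_middle]
    congr 1
    ring
  have h := congrArg Matrix.det hmul
  rw [Matrix.det_mul, Matrix.det_fromBlocks_zero₁₂, Matrix.det_fromBlocks_zero₂₁, Matrix.det_one,
    Matrix.det_one, mul_one, mul_one, hdiag, Matrix.det_fromBlocks_zero₁₂, hL, hR, hM] at h
  rw [hdet, h]

/-! ### Determinants determined by a stretch -/

/-- From `a` on, the sequence `u` has period `p` on a stretch of `2 p + w - 2` places that cannot be
prolonged, and over one period its translate by `w` differs from it only by the interchange of the
last two letters. -/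
structure IsStretch (u : ℕ → ℤ) (a p w : ℕ) (e : ℤ) : Prop where
  even : Even p
  odd : Odd w
  lt : w < p
  coprime : w.Coprime p
  pos : 0 < a
  sq : e * e = 1
  sign : e * revSign p = 1
  periodic : ∀ i, a ≤ i → i < a + p + w - 2 → u (i + p) = u i
  left : u (a - 1 + p) - u (a - 1) = e
  right : u (a + p + w - 2 + p) - u (a + p + w - 2) = -e
  shift : ∀ i < p, u (a + i + w) - u (a + i) =
    e * ((if i + 2 = p then 1 else 0) - (if i + 1 = p then 1 else 0))
  sum : ∑ i ∈ Finset.range p, u (a + i) = w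

theorem neg_one_pow_eq_of_even_add {a b : ℕ} (h : Even (a + b)) : (-1 : ℤ) ^ a = (-1) ^ b := by
  rcases Nat.even_or_odd a with ha | ha
  · rw [ha.neg_one_pow, ((Nat.even_add.mp h).mp ha).neg_one_pow]
  · have hb : Odd b := by
      rw [← Nat.not_even_iff_odd] at ha ⊢
      exact fun hb => ha ((Nat.even_add.mp h).mpr hb)
    rw [ha.neg_one_pow, hb.neg_one_pow]

namespace IsStretch

variable {u : ℕ → ℤ} {a p w : ℕ} {e : ℤ}

theorem hankel_order_period (h : IsStretch u a p w e) (j : ℕ) (hj : j < w) :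
    hankel u (a + j) p = (-1) ^ j * w := by
  have hlt := h.lt
  induction j with
  | zero =>
    rw [add_zero, hankel_period u a p w h.even h.lt (by omega) h.coprime
      (fun i hi => h.periodic _ (by omega) (by omega)) e h.sq h.shift h.sum, mul_right_comm, h.sign]
    simp
  | succ j ih =>
    rw [← add_assoc, hankel_succ_of_periodic u (a + j) p h.even (by omega)
      (fun i hi => h.periodic _ (by omega) (by omega)), ih (by omega), pow_succ]
    ring

/-- The general reduction on the stretch, with `l` rows on the left of it and `r` on the right. -/
theorem hankel_eq (h : IsStretch u a p w e) (m l r : ℕ) (_ : l + r < w) (h1 : a ≤ m + l)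
    (h2 : m + l + l + r < a + w) :
    hankel u m (l + p + r) = revSign l * (u (m + l - 1) - u (m + l - 1 + p)) ^ l *
      (revSign r * (u (m + l + p + l + r - 1 + p) - u (m + l + p + l + r - 1)) ^ r) *
      ((-1) ^ (m + 2 * l - a) * w) := by
  have hlt := h.lt
  rw [hankel_of_periodic_stretch u m l p r (by omega) (by omega)
    (fun i hi hi' => h.periodic i (by omega) (by omega)),
    show m + 2 * l = a + (m + 2 * l - a) by omega, h.hankel_order_period _ (by omega)]
  simp

/-- The start is counted back from the last admissible one; since `w` is odd, the sign is the same
as when counting from `a`. -/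
theorem hankel_bottom (h : IsStretch u a p w e) (m d : ℕ) (hd : d < w) (hm : m + d + 1 = a + w) :
    hankel u m p = (-1) ^ d * w := by
  rw [show m = a + (w - 1 - d) by omega, h.hankel_order_period _ (by omega)]
  congr 1
  obtain ⟨v, hv⟩ := h.odd
  exact neg_one_pow_eq_of_even_add ⟨v, by omega⟩

/-- All `t` extra columns are put on the right, where the antidiagonal of the corner falls exactly
on the right defect. -/
theorem hankel_right (h : IsStretch u a p w e) (m t : ℕ) (ht : t < w) (hm : m + t + 1 = a + w) :
    hankel u m (p + t) = revSign t * e ^ t * w := by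
  have hlt := h.lt
  have := h.hankel_eq m 0 t (by omega) (by omega) (by omega)
  rw [zero_add] at this
  rw [this]
  rcases Nat.eq_zero_or_pos t with rfl | h0
  · obtain ⟨v, hv⟩ := h.odd
    rw [show m + 2 * 0 - a = 2 * v by omega, pow_mul]
    simp [revSign]
  · obtain ⟨v, hv⟩ := h.odd
    rw [show m + 0 + p + 0 + t - 1 = a + p + w - 2 by omega, h.right,
      neg_one_pow_eq_of_even_add (b := t) ⟨v, by omega⟩, neg_eq_neg_one_mul e, mul_pow,
      show revSign 0 = 1 by simp [revSign]]
    have : ((-1 : ℤ) ^ t) * (-1) ^ t = 1 := by rw [← mul_pow]; simp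
    linear_combination (revSign t * e ^ t * w) * this

/-- Mirror image: all extra columns are on the left and the antidiagonal falls on the left defect.
-/
theorem hankel_left (h : IsStretch u a p w e) (m t : ℕ) (ht : t < w) (hm : m + t = a) :
    hankel u m (p + t) = revSign t * e ^ t * w := by
  have hlt := h.lt
  have := h.hankel_eq m t 0 (by omega) (by omega) (by omega)
  rw [add_zero, add_comm t p] at this
  rw [this, show m + 2 * t - a = t by omega, show m + t - 1 = a - 1 by omega,
    show u (a - 1) - u (a - 1 + p) = -1 * e by rw [← h.left]; ring, mul_pow]
  have : ((-1 : ℤ) ^ t) * (-1) ^ t = 1 := by rw [← mul_pow]; simp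
  rw [show revSign 0 = 1 by simp [revSign]]
  linear_combination (revSign t * e ^ t * w) * this

/-- Here `d` extra columns on the left and `w - 1 - d` on the right hit both defects at once. As `w
- 1` is even, the signs combine to one that does not depend on `d`. -/
theorem hankel_top (h : IsStretch u a p w e) (m d : ℕ) (hd : d < w) (hm : m + d = a) :
    hankel u m (p + (w - 1)) = (-1) ^ ((w - 1) / 2) * w := by
  have hlt := h.lt
  have := h.hankel_eq m d (w - 1 - d) (by omega) (by omega) (by omega)
  rw [show d + p + (w - 1 - d) = p + (w - 1) by omega] at this
  rw [this, show m + 2 * d - a = d by omega, show m + d - 1 = a - 1 by omega,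
    show m + d + p + d + (w - 1 - d) - 1 = a + p + w - 2 by omega, h.right,
    show u (a - 1) - u (a - 1 + p) = -e by rw [← h.left]; ring]
  obtain ⟨v, hv⟩ := h.odd
  have he : (-e) ^ d * (-e) ^ (w - 1 - d) = 1 := by
    rw [← pow_add, show d + (w - 1 - d) = 2 * v by omega, pow_mul, neg_sq, pow_two, h.sq, one_pow]
  have hs : revSign d * revSign (w - 1 - d) * (-1) ^ d = (-1) ^ ((w - 1) / 2) := by
    obtain ⟨c, rfl | rfl⟩ := Nat.even_or_odd' d
    · rw [show w - 1 - 2 * c = 2 * (v - c) by omega, revSign_two_mul, revSign_two_mul, pow_mul]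
      rw [← pow_add, show c + (v - c) = (w - 1) / 2 by omega]
      simp
    · rw [show w - 1 - (2 * c + 1) = 2 * (v - c - 1) + 1 by omega, revSign_two_mul_add_one,
        revSign_two_mul_add_one, show (-1 : ℤ) ^ (2 * c + 1) = (-1) ^ 1 by
          rw [pow_add, pow_mul]; simp, ← pow_add, ← pow_add]
      congr 1
      omega
  rw [← hs]
  linear_combination (revSign d * revSign (w - 1 - d) * (-1) ^ d * w) * he

theorem hankel_interior (h : IsStretch u a p w e) (m t d : ℕ) (ht0 : 0 < t) (ht : t + 1 < w)
    (hd0 : 0 < d) (hd : d + 1 < w) (hm : m + t + d + 1 = a + w) : hankel u m (p + t) = 0 := by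
  have hlt := h.lt
  -- Just enough columns go to the left for the middle part to start in the stretch. Then `r > 0`,
  -- and the antidiagonal of the right corner stops short of the right defect, so it is 0.
  obtain ⟨l, r, hlr, hr, h1, h2⟩ : ∃ l r, l + r = t ∧ 0 < r ∧ a ≤ m + l ∧
      m + l + l + r + 1 < a + w := by
    rcases le_total (a) m with hc | hc
    · exact ⟨0, t, by omega, by omega, by omega, by omega⟩
    · exact ⟨a - m, t - (a - m), by omega, by omega, by omega, by omega⟩
  have := h.hankel_eq m l r (by omega) (by omega) (by omega)
  rw [show l + p + r = p + t by omega] at this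
  rw [this, h.periodic (m + l + p + l + r - 1) (by omega) (by omega), sub_self,
    zero_pow (by omega)]
  simp

end IsStretch

/-! ### The images of `1` and `0` -/

theorem tauIter_cons_cons (k : ℕ) (c d : Fin 2) (v : List (Fin 2)) :
    tauIter k (c :: d :: v) = tauIter k [c] ++ tauIter k (d :: v) := tauIter_append k [c] (d :: v)

theorem tauIter_add (j k : ℕ) (v : List (Fin 2)) : tauIter (j + k) v = tauIter j (tauIter k v) := by
  simp [tauIter, Function.iterate_add_apply]

theorem length_one_zero (k : ℕ) : (tauIter k [1]).length + (tauIter k [0]).length = f (2 * k + 1) := by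
  rw [f_odd, tauIter_cons_cons, List.length_append]

/-- The images of `10` and `01` differ only by the interchange of two adjacent letters, which stand
in the middle. -/
theorem near_commute (k : ℕ) : ∃ (C D : List (Fin 2)) (x y : Fin 2),
    tauIter k [1] ++ tauIter k [0] = C ++ x :: y :: D ∧
    tauIter k [0] ++ tauIter k [1] = C ++ y :: x :: D ∧
    C.length = D.length ∧ ((x : ℕ) : ℤ) - ((y : ℕ) : ℤ) = (-1) ^ k := by
  induction k with
  | zero => exact ⟨[], [], 1, 0, by simp [tauIter], by simp [tauIter], rfl, by simp⟩
  | succ k ih =>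
    obtain ⟨C, D, x, y, h1, h2, h3, h4⟩ := ih
    -- The next images of 10 and 01 are A(BA)A and A(AB)A, so the two words exchange roles and the
    -- sign flips.
    refine ⟨tauIter k [1] ++ C, D ++ tauIter k [1], y, x, ?_, ?_, ?_, ?_⟩
    · rw [tauIter_succ_one, tauIter_succ_zero, tauIter_cons_cons, tauIter_cons_cons k 0]
      have := congrArg (fun L => tauIter k [1] ++ (L ++ tauIter k [1])) h2
      simpa using this
    · rw [tauIter_succ_one, tauIter_succ_zero, tauIter_cons_cons, tauIter_cons_cons k 0]
      have := congrArg (fun L => tauIter k [1] ++ (L ++ tauIter k [1])) h1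
      simpa using this
    · simp [h3, add_comm]
    · rw [pow_succ, ← h4]
      ring

theorem count_one (k : ℕ) :
    (tauIter k [1]).count 1 + (tauIter k [0]).count 1 = f (2 * k) ∧
      2 * (tauIter k [1]).count 1 = f (2 * k + 1) := by
  induction k with
  | zero => simp [tauIter, f_zero, f_one]
  | succ k ih =>
    obtain ⟨h1, h2⟩ := ih
    have e1 := f_rec_even k
    have e2 := f_rec_odd k
    rw [show 2 * (k + 1) = 2 * k + 2 by ring, show 2 * k + 2 + 1 = 2 * k + 3 by ring,
      tauIter_succ_one, tauIter_succ_zero, tauIter_cons_cons, tauIter_cons_cons k 0,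
      List.count_append, List.count_append]
    omega

theorem coprime_f (k : ℕ) : (f (2 * k)).Coprime (f (2 * k + 1)) := by
  induction k with
  | zero => simp [f_zero]
  | succ k ih =>
    rw [show 2 * (k + 1) = 2 * k + 2 by ring, show 2 * k + 2 + 1 = 2 * k + 3 by ring, f_rec_odd,
      Nat.coprime_add_self_right, f_rec_even]
    rw [Nat.coprime_self_add_left]
    exact ih.symm

theorem odd_f_even (k : ℕ) : Odd (f (2 * k)) := by
  rw [← Nat.not_even_iff_odd]
  intro h
  have := Nat.eq_one_of_dvd_coprimes (coprime_f k) h.two_dvd (even_f_odd k).two_dvd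
  omega

theorem f_odd_le (k : ℕ) : f (2 * k + 1) ≤ 2 * f (2 * k) := by
  rcases k with _ | k
  · simp [f_zero, f_one]
  · have e1 := f_rec_even k
    have e2 := f_rec_odd k
    rw [show 2 * (k + 1) = 2 * k + 2 by ring, show 2 * k + 2 + 1 = 2 * k + 3 by ring]
    omega

/-- Half of f_{2k+1} grows by the odd number f_{2k} when `k` grows by one, so its parity alternates.
-/
theorem revSign_f_odd (k : ℕ) : (-1) ^ (k + 1) * revSign (f (2 * k + 1)) = 1 := by
  obtain ⟨q, hq⟩ := (even_f_odd k).two_dvd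
  rw [hq, revSign_two_mul]
  have : Even (k + 1 + q) := by
    induction k generalizing q with
    | zero =>
      rw [f_one] at hq
      rw [show q = 1 by omega]
      decide
    | succ k ih =>
      obtain ⟨q', hq'⟩ := (even_f_odd k).two_dvd
      have h1 := ih q' hq'
      have e1 := f_rec_even k
      have e2 := f_rec_odd k
      rw [show 2 * (k + 1) + 1 = 2 * k + 3 by ring] at hq
      obtain ⟨v, hv⟩ := odd_f_even k
      rw [show k + 1 + 1 + q = (k + 1 + q') + 2 * (v + 1) by omega]
      exact h1.add (even_two_mul _)
  rw [← pow_add, this.neg_one_pow]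

/-! ### The stretch inside an image of 11011 -/

/-- The letter at position `i` of a word, as an integer. -/
def letter (L : List (Fin 2)) (i : ℕ) : ℤ := ((L.getD i 0 : Fin 2) : ℕ)

theorem letter_append_left (L L' : List (Fin 2)) (i : ℕ) (h : i < L.length) :
    letter (L ++ L') i = letter L i := by
  rw [letter, List.getD_append _ _ _ _ h, letter]

theorem letter_append_right (L L' : List (Fin 2)) (i : ℕ) :
    letter (L ++ L') (L.length + i) = letter L' i := by
  rw [letter, List.getD_append_right _ _ _ _ (by omega), letter, Nat.add_sub_cancel_left]

theorem sum_letter (L : List (Fin 2)) :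
    ∑ i ∈ Finset.range L.length, letter L i = (L.count 1 : ℤ) := by
  induction L with
  | nil => simp
  | cons c L ih =>
    rw [List.length_cons, Finset.sum_range_succ']
    have : ∀ i, letter (c :: L) (i + 1) = letter L i := fun i => by simp [letter]
    simp only [this, ih, List.count_cons]
    fin_cases c <;> simp [letter]

/-- A stretch appears wherever the image of `11011` does. -/
theorem isStretch_of_factor (k b : ℕ) (u : ℕ → ℤ)
    (hu : ∀ i < 3 * f (2 * k) + f (2 * k + 1), u (b + i) = letter (tauIter k [1, 1, 0, 1, 1]) i) :
    IsStretch u (b + f (2 * k) + 1 - f (2 * k + 1) / 2) (f (2 * k + 1)) (f (2 * k)) ((-1) ^ (k + 1)) := by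
  obtain ⟨C, D, x, y, h1, h2, h3, h4⟩ := near_commute k
  obtain ⟨hc1, hc2⟩ := count_one k
  have hlen1 := f_even k
  have hlen := length_one_zero k
  have hle := f_odd_le k
  have hlt := f_lt_succ (2 * k)
  have hcop := coprime_f k
  have heven := even_f_odd k
  have hodd := odd_f_even k
  have hsign := revSign_f_odd k
  have hw0 := f_pos (2 * k)
  have hV : tauIter k [1, 1, 0, 1, 1] = tauIter k [1] ++ (tauIter k [1] ++ (tauIter k [0] ++
      (tauIter k [1] ++ tauIter k [1]))) := by
    rw [tauIter_cons_cons, tauIter_cons_cons k 1 0, tauIter_cons_cons k 0,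
      tauIter_cons_cons k 1 1]
  rw [hV] at hu
  generalize tauIter k [1] = A at *
  generalize tauIter k [0] = B at *
  generalize f (2 * k) = w at *
  generalize f (2 * k + 1) = p at *
  obtain rfl := hlen1
  -- With c = |C| the stretch starts at b + w - c, which is after `b` because p ≤ 2w.
  have hlC : p = 2 * C.length + 2 := by
    have := congrArg List.length h1
    simp only [List.length_append, List.length_cons] at this
    omega
  have hp2 : p / 2 = C.length + 1 := by omega
  rw [hp2]
  generalize hcc : C.length = c at *
  -- the five factors
  have v0 : ∀ i < A.length, u (b + i) = letter A i := by
    intro i hi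
    rw [hu i (by omega), letter_append_left _ _ _ hi]
  have v1 : ∀ i < p, u (b + A.length + i) = letter (A ++ B) i := by
    intro i hi
    rw [add_assoc, hu _ (by omega), letter_append_right, ← List.append_assoc,
      letter_append_left _ _ _ (by rw [List.length_append]; omega)]
  have v2 : ∀ i < p, u (b + 2 * A.length + i) = letter (B ++ A) i := by
    intro i hi
    rw [add_assoc, hu _ (by omega), two_mul, add_assoc, letter_append_right, letter_append_right,
      ← List.append_assoc, letter_append_left _ _ _ (by rw [List.length_append]; omega)]
  have v3 : ∀ i < A.length, u (b + A.length + p + i) = letter A i := by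
    intro i hi
    rw [show b + A.length + p + i = b + (A.length + (A.length + (B.length + i))) by omega,
      hu _ (by omega), letter_append_right, letter_append_right, letter_append_right,
      letter_append_left _ _ _ hi]
  have v4 : ∀ i < A.length, u (b + 2 * A.length + p + i) = letter A i := by
    intro i hi
    rw [show b + 2 * A.length + p + i =
      b + (A.length + (A.length + (B.length + (A.length + i)))) by omega,
      hu _ (by omega), letter_append_right, letter_append_right, letter_append_right,
      letter_append_right]
  have a1 : ∀ i < A.length, letter A i = letter (A ++ B) i := fun i hi =>
    (letter_append_left _ _ _ hi).symm
  -- A is read both as a prefix of AB and as a suffix of BA, so every comparison below becomes one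
  -- of AB with BA, which differ only at `c` and `c + 1`.
  have a2 : ∀ i < A.length, letter A i = letter (B ++ A) (p - A.length + i) := by
    intro i hi
    rw [show p - A.length + i = B.length + i by omega, letter_append_right]
  have q1 : ∀ i < c, letter (A ++ B) i = letter (B ++ A) i := by
    intro i hi
    rw [h1, h2, letter_append_left _ _ _ (by omega), letter_append_left _ _ _ (by omega)]
  have q2 : letter (A ++ B) c = ((x : ℕ) : ℤ) := by
    rw [h1, ← hcc, ← add_zero C.length, letter_append_right]; simp [letter]
  have q3 : letter (A ++ B) (c + 1) = ((y : ℕ) : ℤ) := by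
    rw [h1, ← hcc, letter_append_right]; simp [letter]
  have q4 : letter (B ++ A) c = ((y : ℕ) : ℤ) := by
    rw [h2, ← hcc, ← add_zero C.length, letter_append_right]; simp [letter]
  have q5 : letter (B ++ A) (c + 1) = ((x : ℕ) : ℤ) := by
    rw [h2, ← hcc, letter_append_right]; simp [letter]
  have q6 : ∀ i, letter (A ++ B) (c + 2 + i) = letter (B ++ A) (c + 2 + i) := by
    intro i
    rw [h1, h2, ← hcc, add_assoc, letter_append_right, letter_append_right]
    simp [letter, add_comm 2 i]
  have hsumP : ∑ i ∈ Finset.range p, letter (A ++ B) i = A.length := by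
    rw [← hlen, ← List.length_append, sum_letter, List.count_append, hc1]
  generalize letter (A ++ B) = P at *
  generalize letter (B ++ A) = Q at *
  generalize letter A = R at *
  generalize A.length = w at *
  refine ⟨heven, hodd, hlt, hcop, by omega, ?_, hsign, ?_, ?_, ?_, ?_, ?_⟩
  · rw [← mul_pow]; simp
  · intro i hi hi'
    rcases lt_or_ge i (b + w) with hi1 | hi1
    · obtain ⟨j, rfl⟩ : ∃ j, i = b + (w - c + j) := ⟨i - b - (w - c), by omega⟩
      rw [v0 _ (by omega), a2 _ (by omega), show p - w + (w - c + j) = c + 2 + j by omega,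
        show b + (w - c + j) + p = b + w + (c + 2 + j) by omega, v1 _ (by omega), q6]
    rcases lt_or_ge i (b + 2 * w) with hi2 | hi2
    · rw [show i + p = b + w + p + (i - b - w) by omega, v3 _ (by omega), a1 _ (by omega),
        ← v1 _ (by omega)]
      congr 1
      omega
    · rw [show i + p = b + 2 * w + p + (i - b - 2 * w) by omega, v4 _ (by omega), a1 _ (by omega),
        q1 _ (by omega), ← v2 _ (by omega)]
      congr 1
      omega
  · rw [show b + w + 1 - (c + 1) - 1 = b + (w - c - 1) by omega, v0 _ (by omega), a2 _ (by omega),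
      show b + (w - c - 1) + p = b + w + (c + 1) by omega, v1 _ (by omega),
      show p - w + (w - c - 1) = c + 1 by omega, q3, q5, pow_succ, ← h4]
    ring
  · rw [show b + w + 1 - (c + 1) + p + w - 2 = b + 2 * w + c by omega, v2 _ (by omega),
      show b + 2 * w + c + p = b + 2 * w + p + c by omega, v4 _ (by omega), a1 _ (by omega), q2, q4,
      pow_succ, ← h4]
    ring
  · intro i hi
    rcases lt_or_ge i c with hic | hic
    · rw [if_neg (by omega), if_neg (by omega),
        show b + w + 1 - (c + 1) + i + w = b + w + (w - c + i) by omega, v1 _ (by omega),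
        show b + w + 1 - (c + 1) + i = b + (w - c + i) by omega, v0 _ (by omega), a1 _ (by omega)]
      simp
    · obtain ⟨j, rfl⟩ := Nat.exists_eq_add_of_le hic
      rw [show b + w + 1 - (c + 1) + (c + j) + w = b + 2 * w + j by omega, v2 _ (by omega),
        show b + w + 1 - (c + 1) + (c + j) = b + w + j by omega, v1 _ (by omega)]
      rcases lt_trichotomy j c with hj | rfl | hj
      · rw [if_neg (by omega), if_neg (by omega), q1 _ hj]
        simp
      · rw [if_pos (by omega), if_neg (by omega), q2, q4, pow_succ, ← h4]
        ring
      · rw [show j = c + 1 by omega, if_neg (by omega), if_pos (by omega), q3, q5, pow_succ, ← h4]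
        ring
  -- The period starting at the stretch is D followed by C and the two middle letters, a rotation of
  -- AB, which contains `w` ones.
  · have e1 : ∑ i ∈ Finset.range p, u (b + w + 1 - (c + 1) + i) =
        ∑ i ∈ Finset.range c, u (b + w + 1 - (c + 1) + i) +
          ∑ i ∈ Finset.range (c + 2), u (b + w + 1 - (c + 1) + (c + i)) := by
      rw [← Finset.sum_range_add, show c + (c + 2) = p by omega]
    have e2 : ∑ i ∈ Finset.range p, P i =
        ∑ i ∈ Finset.range (c + 2), P i + ∑ i ∈ Finset.range c, P (c + 2 + i) := by
      rw [← Finset.sum_range_add, show c + 2 + c = p by omega]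
    rw [← hsumP, e1, e2, add_comm]
    congr 1
    · apply Finset.sum_congr rfl
      intro i hi
      have hi := Finset.mem_range.mp hi
      rw [← v1 _ (by omega)]
      congr 1
      omega
    · apply Finset.sum_congr rfl
      intro i hi
      have hi := Finset.mem_range.mp hi
      rw [show b + w + 1 - (c + 1) + i = b + (w - c + i) by omega, v0 _ (by omega), a2 _ (by omega),
        show p - w + (w - c + i) = c + 2 + i by omega, q6]

/-! ### Reading off the place of a factor from the digits -/

/-- The word of length `f n` that belongs to the digit at position `n`. -/
def blockWord (n : ℕ) : List (Fin 2) :=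
  if n % 2 = 0 then tauIter (n / 2) [1] else tauIter (n / 2) [1, 0]

theorem blockWord_even (j : ℕ) : blockWord (2 * j) = tauIter j [1] := by
  simp [blockWord]

theorem blockWord_odd (j : ℕ) : blockWord (2 * j + 1) = tauIter j [1, 0] := by
  have h1 : (2 * j + 1) % 2 = 1 := by omega
  have h2 : (2 * j + 1) / 2 = j := by omega
  simp [blockWord, h1, h2]

theorem blockWord_rec_even (j : ℕ) :
    blockWord (2 * j + 2) = blockWord (2 * j + 1) ++ blockWord (2 * j) := by
  rw [show 2 * j + 2 = 2 * (j + 1) by ring, blockWord_even, blockWord_even, blockWord_odd,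
    tauIter_succ_one]
  exact tauIter_append j [1, 0] [1]

theorem blockWord_rec_odd (j : ℕ) :
    blockWord (2 * j + 3) = blockWord (2 * j + 2) ++ blockWord (2 * j) := by
  rw [show 2 * j + 2 = 2 * (j + 1) by ring, show 2 * j + 3 = 2 * (j + 1) + 1 by ring,
    blockWord_even, blockWord_even, blockWord_odd, tauIter_cons_cons, tauIter_succ_zero]

theorem blockWord_prefix_succ (n : ℕ) : blockWord n <+: blockWord (n + 1) := by
  obtain ⟨j, rfl | rfl⟩ := Nat.even_or_odd' n
  · rw [blockWord_even, blockWord_odd, tauIter_cons_cons]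
    exact List.prefix_append _ _
  · rw [blockWord_rec_even]
    exact List.prefix_append _ _

theorem length_tauIter_blockWord (K n : ℕ) : (tauIter K (blockWord n)).length = f (n + 2 * K) := by
  obtain ⟨j, rfl | rfl⟩ := Nat.even_or_odd' n
  · rw [blockWord_even, ← tauIter_add, ← f_even]
    congr 1
    ring
  · rw [blockWord_odd, ← tauIter_add, ← f_odd]
    congr 1
    ring

/-- A sum of terms `f (i + 2 K)`, `i ≥ 1`, with admissible digits is the length of the `K`-th image
of a prefix of the fixed point after which the letter `1` follows. -/
theorem exists_prefix_of_digits (K : ℕ) (b : ℕ → ℕ) (hb : ∀ i, b i = 0 ∨ b i = 1) (hb0 : b 0 = 0)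
    (hadj : ∀ i, b i * b (i + 1) = 0) (heven : ∀ i, Even i → b i * b (i + 2) = 0) (t : ℕ) :
    ∃ P : List (Fin 2), (tauIter K P).length = ∑ i ∈ Finset.range t, b i * f (i + 2 * K) ∧
      P ++ [1] <+: blockWord t := by
  induction t using Nat.strong_induction_on with
  | _ t ih =>
    rcases t with _ | t
    · refine ⟨[], ?_, ?_⟩
      · have := tauIter_append K [] []
        simpa using congrArg List.length this
      · exact List.prefix_rfl
    rcases hb t with h | h
    · obtain ⟨P, hP, hp⟩ := ih t (by omega)
      exact ⟨P, by rw [Finset.sum_range_succ, h, hP]; simp, hp.trans (blockWord_prefix_succ t)⟩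
    · obtain ⟨j, rfl | rfl⟩ := Nat.even_or_odd' t
      · rcases j with _ | j
        -- Without `b 0 = 0` the prefix could be the word 1, which the fixed point continues with 0.
        · simp [hb0] at h
        · have h1 : b (2 * j + 1) = 0 := by
            have := hadj (2 * j + 1)
            rw [show 2 * j + 1 + 1 = 2 * (j + 1) by ring, h] at this
            simpa using this
          have h2 : b (2 * j) = 0 := by
            have := heven (2 * j) (by simp)
            rw [show 2 * j + 2 = 2 * (j + 1) by ring, h] at this
            simpa using this
          obtain ⟨P, hP, hp⟩ := ih (2 * j) (by omega)
          refine ⟨blockWord (2 * j + 2) ++ P, ?_, ?_⟩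
          · rw [show 2 * (j + 1) = 2 * j + 1 + 1 by ring] at h ⊢
            rw [Finset.sum_range_succ, Finset.sum_range_succ, Finset.sum_range_succ, h, h1, h2,
              tauIter_append, List.length_append, length_tauIter_blockWord, hP]
            ring_nf
          · rw [show 2 * (j + 1) + 1 = 2 * j + 3 by ring, blockWord_rec_odd, List.append_assoc]
            exact (List.prefix_append_right_inj _).mpr hp
      · have h2 : b (2 * j) = 0 := by
          have := hadj (2 * j)
          rw [h] at this
          simpa using this
        obtain ⟨P, hP, hp⟩ := ih (2 * j) (by omega)
        refine ⟨blockWord (2 * j + 1) ++ P, ?_, ?_⟩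
        · rw [Finset.sum_range_succ, Finset.sum_range_succ, h, h2, tauIter_append,
            List.length_append, length_tauIter_blockWord, hP]
          ring
        · rw [show 2 * j + 1 + 1 = 2 * j + 2 by ring, blockWord_rec_even, List.append_assoc]
          exact (List.prefix_append_right_inj _).mpr hp

theorem blockWord_prefix_tauIter (t : ℕ) : blockWord t <+: tauIter (t + 1) [1] := by
  obtain ⟨j, rfl | rfl⟩ := Nat.even_or_odd' t
  · rw [blockWord_even]
    exact tauIter_prefix_of_le (by omega)
  · refine (blockWord_prefix_succ _).trans ?_
    rw [show 2 * j + 1 + 1 = 2 * (j + 1) by ring, blockWord_even]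
    exact tauIter_prefix_of_le (by omega)

/-- The fixed point, preceded by the `k`-th image of `1`. -/
def extSeq (k i : ℕ) : ℤ :=
  if i < f (2 * k) then letter (tauIter k [1]) i else ((sSeq (i - f (2 * k)) : ℕ) : ℤ)

theorem hankelDet_eq_hankel_extSeq (k m n : ℕ) :
    hankelDet m n = hankel (extSeq k) (m + f (2 * k)) n := by
  rw [hankelDet, hankel]
  congr 1
  ext i j
  simp only [Matrix.of_apply, extSeq]
  rw [if_neg (by omega), show m + f (2 * k) + i + j - f (2 * k) = m + i + j by omega]

theorem extSeq_eq_letter (k N i : ℕ) (hi : i < f (2 * k) + (tauIter N [1]).length) :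
    extSeq k i = letter (tauIter k [1] ++ tauIter N [1]) i := by
  rw [extSeq]
  split_ifs with h
  · rw [letter_append_left _ _ _ (by rw [← f_even]; exact h)]
  · obtain ⟨j, rfl⟩ := Nat.exists_eq_add_of_le (not_lt.mp h)
    rw [f_even, letter_append_right, ← f_even, letter, Nat.add_sub_cancel_left,
      ← sSeq_spec N j (by omega), List.getD_eq_getElem _ _ (by omega)]

theorem exists_tauIter_succ_eq_append (k : ℕ) (c : Fin 2) :
    ∃ R, tauIter (k + 1) [c] = tauIter k [1] ++ R := by
  fin_cases c
  · exact ⟨[], by simp [tauIter_succ_zero]⟩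
  · exact ⟨tauIter k [0, 1], by simp only [Fin.mk_one, tauIter_succ_one, tauIter_cons_cons k 1 0]⟩

theorem exists_tauIter_succ_eq_append' (k : ℕ) (c : Fin 2) :
    ∃ R, tauIter (k + 1) [c] = R ++ tauIter k [1] := by
  fin_cases c
  · exact ⟨[], by simp [tauIter_succ_zero]⟩
  · refine ⟨tauIter k [1, 0], ?_⟩
    simp only [Fin.mk_one, tauIter_succ_one]
    exact tauIter_append k [1, 0] [1]

/-- The letter 1 after `P` has the image ABA, and the image of either letter under k + 1
substitutions begins and ends with A. So the neighbours supply the outer copies of A; for empty `P`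
the copy put in front of the fixed point does. That copy also makes the factor start at the length
of the image of `P`. -/
theorem extSeq_factor (k t : ℕ) (P : List (Fin 2)) (hP : P ++ [1] <+: blockWord t) (i : ℕ)
    (hi : i < 3 * f (2 * k) + f (2 * k + 1)) :
    extSeq k ((tauIter (k + 1) P).length + i) = letter (tauIter k [1, 1, 0, 1, 1]) i := by
  obtain ⟨N, c, R, hN⟩ : ∃ N c R, tauIter N [1] = P ++ 1 :: c :: R := by
    set N := t + 1 + (P.length + 1) with hN
    obtain ⟨R, hR⟩ := (hP.trans (blockWord_prefix_tauIter t)).trans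
      (tauIter_prefix_of_le (show t + 1 ≤ N by omega))
    rcases R with _ | ⟨c, R⟩
    · have h1 := lt_length_tauIter N
      have h2 := congrArg List.length hR
      simp at h2
      omega
    · exact ⟨N, c, R, by rw [← hR]; simp⟩
  obtain ⟨S, hS⟩ := exists_tauIter_succ_eq_append k c
  have hV : tauIter k [1, 1, 0, 1, 1] = tauIter k [1] ++ (tauIter k [1, 0, 1] ++ tauIter k [1]) := by
    rw [← tauIter_append, ← tauIter_append]
    rfl
  have hsplit : tauIter (k + 1 + N) [1] = tauIter (k + 1) P ++ (tauIter k [1, 0, 1] ++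
      (tauIter k [1] ++ (S ++ tauIter (k + 1) R))) := by
    rw [tauIter_add, hN, tauIter_append, show (1 : Fin 2) :: c :: R = [1] ++ ([c] ++ R) from rfl,
      tauIter_append, tauIter_append, hS, tauIter_succ_one]
    simp
  obtain ⟨Q, hQ⟩ : ∃ Q, tauIter k [1] ++ tauIter (k + 1) P = Q ++ tauIter k [1] := by
    rcases List.eq_nil_or_concat P with rfl | ⟨P', c', rfl⟩
    · refine ⟨[], ?_⟩
      have := tauIter_append (k + 1) [] []
      have h0 : tauIter (k + 1) [] = [] := by simpa using this
      simp [h0]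
    · obtain ⟨S', hS'⟩ := exists_tauIter_succ_eq_append' k c'
      refine ⟨tauIter k [1] ++ (tauIter (k + 1) P' ++ S'), ?_⟩
      rw [List.concat_eq_append, tauIter_append, hS']
      simp
  have hQl : Q.length = (tauIter (k + 1) P).length := by
    have := congrArg List.length hQ
    simp only [List.length_append] at this
    omega
  have hVl : (tauIter k [1, 1, 0, 1, 1]).length = 3 * f (2 * k) + f (2 * k + 1) := by
    have e : tauIter k [1, 0, 1] = tauIter k [1, 0] ++ tauIter k [1] := tauIter_append k [1, 0] [1]
    rw [hV, e, List.length_append, List.length_append, List.length_append, ← f_even, ← f_odd]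
    ring
  have hall : tauIter k [1] ++ tauIter (k + 1 + N) [1] =
      Q ++ (tauIter k [1, 1, 0, 1, 1] ++ (S ++ tauIter (k + 1) R)) := by
    rw [hsplit, ← List.append_assoc, hQ, hV]
    simp
  have hl := congrArg List.length hall
  rw [List.length_append, ← f_even, List.length_append, List.length_append, hVl] at hl
  rw [← hQl, extSeq_eq_letter k (k + 1 + N) _ (by omega), hall, letter_append_right,
    letter_append_left _ _ _ (by omega)]

theorem digit_eq {n : ℕ} {a : ℕ →₀ ℕ} (h : IsFRep n a) (i : ℕ) : digit n i = a i := by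
  rw [digit, (existsUnique_isFRep n).choose_spec.1.unique h]

theorem Phi_eq {n : ℕ} {a : ℕ →₀ ℕ} (h : IsFRep n a) (k : ℕ) :
    Phi k n = ∑ i ∈ Finset.range (2 * k + 3), a i * f i :=
  Finset.sum_congr rfl fun i _ => by rw [digit_eq h]

/-- The part of an integer that the truncation `Phi k` removes is the place of an image of `11011`
in the fixed point, and `Phi k` of slightly larger integers is their distance from it. -/
theorem exists_place (k x : ℕ) : ∃ y, x = y + Phi k x ∧
    (∀ i < 3 * f (2 * k) + f (2 * k + 1),
      extSeq k (y + i) = letter (tauIter k [1, 1, 0, 1, 1]) i) ∧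
    ∀ r < f (2 * k + 2), Phi k (y + r) = r := by
  obtain ⟨a, ha, h0⟩ := exists_isFRep_of_lt (x + 1) x
    (lt_of_lt_of_le (Nat.lt_succ_self x) f_strictMono.le_apply)
  set up : ℕ →₀ ℕ := a.filter (fun i => 2 * k + 3 ≤ i) with hup
  have hup1 : ∀ i, 2 * k + 3 ≤ i → up i = a i := fun i hi => Finsupp.filter_apply_pos _ _ hi
  have hup0 : ∀ i, i < 2 * k + 3 → up i = 0 := fun i hi =>
    Finsupp.filter_apply_neg _ _ (not_le.mpr hi)
  have hle : ∀ i, up i ≤ a i := by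
    intro i
    rcases lt_or_ge i (2 * k + 3) with h | h
    · rw [hup0 i h]; omega
    · rw [hup1 i h]
  have hupd : ∀ i, up i = 0 ∨ up i = 1 := by
    intro i
    have := hle i
    have := ha.digit i
    omega
  have hupadj : ∀ i, up i * up (i + 1) = 0 := fun i =>
    Nat.le_zero.mp ((Nat.mul_le_mul (hle _) (hle _)).trans (ha.adj i).le)
  have hupeven : ∀ i, Even i → up i * up (i + 2) = 0 := fun i hi =>
    Nat.le_zero.mp ((Nat.mul_le_mul (hle _) (hle _)).trans (ha.even_adj i hi).le)
  -- The sum starts at 2k + 2, where the digit is 0, to fit `exists_prefix_of_digits` with K = k + 1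
  -- and `b 0 = 0`.
  set y := ∑ i ∈ Finset.range (x + 1), up (2 * k + 2 + i) * f (2 * k + 2 + i) with hy
  have hysum : (up.sum fun i c => c * f i) = y := by
    rw [sum_eq_sum_range up (2 * k + 2 + (x + 1)), Finset.sum_range_add, Finset.sum_eq_zero, zero_add]
    · intro i hi
      rw [hup0 i (by have := Finset.mem_range.mp hi; omega), zero_mul]
    · intro i hi
      rw [hup1 i (by omega), h0 i (by omega)]
  refine ⟨y, ?_, ?_, ?_⟩
  · rw [Phi_eq ha]
    have h1 := ha.sum_eq
    have h2 : ∀ i, up (2 * k + 3 + i) = a (2 * k + 3 + i) := fun i => hup1 _ (by omega)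
    rw [sum_eq_sum_range a (2 * k + 3 + (x + 1)) (fun i hi => h0 i (by omega)),
      Finset.sum_range_add] at h1
    rw [sum_eq_sum_range up (2 * k + 3 + (x + 1)), Finset.sum_range_add, Finset.sum_eq_zero,
      zero_add] at hysum
    · simp only [h2] at hysum
      omega
    · intro i hi
      rw [hup0 i (Finset.mem_range.mp hi), zero_mul]
    · intro i hi
      rw [hup1 i (by omega), h0 i (by omega)]
  · obtain ⟨P, hP, hp⟩ := exists_prefix_of_digits (k + 1) (fun i => up (2 * k + 2 + i))
      (fun i => hupd _) (hup0 _ (by omega)) (fun i => hupadj _)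
      (fun i hi => hupeven _ (Even.add ⟨k + 1, by ring⟩ hi)) (x + 1)
    have hPy : (tauIter (k + 1) P).length = y := by
      rw [hP, hy]
      refine Finset.sum_congr rfl fun i _ => ?_
      rw [show i + 2 * (k + 1) = 2 * k + 2 + i by ring]
    intro i hi
    rw [← hPy]
    exact extSeq_factor k (x + 1) P hp i hi
  · intro r hr
    obtain ⟨b, hb, hb0⟩ := exists_isFRep_of_lt (2 * k + 2) r hr
    have hrep : IsFRep (y + r) (up + b) := by
      refine ⟨fun i => ?_, fun i => ?_, fun i hi => ?_, ?_⟩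
      · rw [Finsupp.add_apply]
        rcases lt_or_ge i (2 * k + 3) with h | h
        · rw [hup0 i h, zero_add]
          exact hb.digit i
        · rw [hb0 i (by omega), add_zero]
          exact hupd i
      · rw [Finsupp.add_apply, Finsupp.add_apply]
        rcases lt_or_ge i (2 * k + 2) with h | h
        · rw [hup0 i (by omega), hup0 (i + 1) (by omega), zero_add, zero_add]
          exact hb.adj i
        · rw [hb0 i h, hb0 (i + 1) (by omega), add_zero, add_zero]
          exact hupadj i
      · rw [Finsupp.add_apply, Finsupp.add_apply]
        rcases lt_or_ge i (2 * k + 1) with h | h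
        · rw [hup0 i (by omega), hup0 (i + 2) (by omega), zero_add, zero_add]
          exact hb.even_adj i hi
        -- Digits at 2k + 1 and 2k + 3 may both be 1, since the condition at distance two concerns
        -- even positions only.
        · have : i ≠ 2 * k + 1 := by
            rintro rfl
            simp at hi
          rw [hb0 i (by omega), hb0 (i + 2) (by omega), add_zero, add_zero]
          exact hupeven i hi
      · rw [Finsupp.sum_add_index' (by simp) (by intros; ring), hysum, hb.sum_eq]
    rw [Phi_eq hrep, ← hb.sum_eq, sum_eq_sum_range b (2 * k + 3) (fun i hi => hb0 i (by omega))]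
    refine Finset.sum_congr rfl fun i hi => ?_
    rw [Finsupp.add_apply, hup0 i (Finset.mem_range.mp hi), zero_add]

/-! ### Signs, and the stretch belonging to γ_i -/

theorem sgn_natCast (n : ℕ) : sgn (n : ℤ) = (-1) ^ n := by
  rw [sgn, Int.negOnePow_def]
  simp

theorem sgn_half_mul_sub_one (n : ℕ) : sgn ((n : ℤ) * ((n : ℤ) - 1) / 2) = revSign n := by
  have key : ∀ n : ℕ, ∃ q : ℕ, (n : ℤ) * ((n : ℤ) - 1) = 2 * q ∧ revSign n = (-1) ^ q := by
    intro n
    induction n with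
    | zero => exact ⟨0, by simp [revSign]⟩
    | succ n ih =>
      obtain ⟨q, h1, h2⟩ := ih
      refine ⟨q + n, ?_, ?_⟩
      · push_cast
        linear_combination h1
      · rw [revSign_succ, h2, pow_add]
  obtain ⟨q, h1, h2⟩ := key n
  rw [h1, h2, Int.mul_ediv_cancel_left _ (by norm_num), sgn_natCast]

/-- The stretch around an element of `E' k`. -/
theorem exists_stretch (k x : ℕ) (hx : x ∈ E' k) : ∃ a,
    IsStretch (extSeq k) a (f (2 * k + 1)) (f (2 * k)) ((-1) ^ (k + 1)) ∧
    a + f (2 * k + 1) = x + 1 ∧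
    ∀ d < f (2 * k), Phi k (x - d) = f (2 * k) + f (2 * k + 1) / 2 - d := by
  obtain ⟨y, h1, h2, h3⟩ := exists_place k x
  have hx' : Phi k x = f (2 * k + 3) / 2 := hx
  have e1 := f_rec_even k
  have e2 := f_rec_odd k
  have hle := f_odd_le k
  obtain ⟨q, hq⟩ := (even_f_odd k).two_dvd
  have hpos := f_pos (2 * k + 1)
  -- As f_{2k+3}/2 = w + p/2, we have x = y + w + p/2, while the stretch starts at y + w + 1 - p/2.
  refine ⟨_, isStretch_of_factor k y _ h2, by omega, fun d hd => ?_⟩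
  rw [show x - d = y + (f (2 * k) + f (2 * k + 1) / 2 - d) by omega]
  exact h3 _ (by omega)

/-- Converts between heights measured from the top edge (`N`) and from the bottom edge (`t`), which
have the same parity; on the slanted edges 2h = f_{2k} - 1. -/
theorem edge_sign (k t N h : ℕ) (hN : N + t = 2 * h) :
    (-1 : ℤ) ^ (N * k) * revSign N * (-1) ^ h = revSign t * ((-1) ^ (k + 1)) ^ t := by
  rw [← pow_mul]
  obtain ⟨c, rfl | rfl⟩ := Nat.even_or_odd' t
  · rw [show N = 2 * (h - c) by omega, revSign_two_mul, revSign_two_mul, mul_assoc, ← pow_add,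
      ← pow_add, ← pow_add]
    refine neg_one_pow_eq_of_even_add ?_
    obtain ⟨g, rfl⟩ : ∃ g, h = c + g := ⟨h - c, by omega⟩
    refine ⟨g * k + g + c + (k + 1) * c, ?_⟩
    rw [Nat.add_sub_cancel_left]
    ring
  · rw [show N = 2 * (h - c - 1) + 1 by omega, revSign_two_mul_add_one, revSign_two_mul_add_one,
      ← pow_add, ← pow_add, ← pow_add]
    refine neg_one_pow_eq_of_even_add ?_
    obtain ⟨g, rfl⟩ : ∃ g, h = c + 1 + g := ⟨h - c - 1, by omega⟩
    refine ⟨g * k + k + g + c + 1 + (k + 1) * c, ?_⟩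
    rw [show c + 1 + g - c - 1 = g by omega]
    ring

end TauHankel

theorem theorem3 (k m n : ℕ) (hmn : (m, n) ∈ TauHankel.T k) :
    -- top edge
    (n = TauHankel.f (2 * k + 2) - 1 →
      TauHankel.hankelDet m n =
        TauHankel.sgn (((TauHankel.f (2 * k) : ℤ) - 1) / 2) * TauHankel.f (2 * k)) ∧
    -- bottom edge
    (n = TauHankel.f (2 * k + 1) →
      TauHankel.hankelDet m n =
        TauHankel.sgn ((TauHankel.Phi k (m + n) : ℤ) - (TauHankel.f (2 * k + 1) : ℤ) / 2 - 1) *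
          TauHankel.f (2 * k)) ∧
    -- between the two horizontal edges
    (TauHankel.f (2 * k + 1) < n → n < TauHankel.f (2 * k + 2) - 1 →
      -- on the slanted edges
      ((∃ i : ℕ, 1 ≤ i ∧
          ((m + n : ℤ) = TauHankel.gam k i - TauHankel.f (2 * k) + 1 ∨
            m + n = TauHankel.gam k i)) →
        TauHankel.hankelDet m n =
          TauHankel.sgn (((TauHankel.f (2 * k + 2) : ℤ) - 1 - n) * k) *
          TauHankel.sgn ((((TauHankel.f (2 * k + 2) : ℤ) - 1 - n) *
            ((TauHankel.f (2 * k + 2) : ℤ) - 2 - n)) / 2) *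
          TauHankel.sgn (((TauHankel.f (2 * k) : ℤ) - 1) / 2) * TauHankel.f (2 * k)) ∧
      -- in the interior
      ((¬ ∃ i : ℕ, 1 ≤ i ∧
          ((m + n : ℤ) = TauHankel.gam k i - TauHankel.f (2 * k) + 1 ∨
            m + n = TauHankel.gam k i)) →
        TauHankel.hankelDet m n = 0)) := by
  open TauHankel in
  obtain ⟨i, hi, h1, h2, h3, h4⟩ : ∃ i, 1 ≤ i ∧ (m, n) ∈ TPar k i := by
    simpa [T] using hmn
  simp only at h1 h2 h3 h4
  have hgam : ∀ i, gam k i ∈ E' k := fun i => Nat.nth_mem_of_infinite (infinite_E' k) _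
  have e1 := f_rec_even k
  have hpos := f_pos (2 * k)
  obtain ⟨v, hv⟩ := odd_f_even k
  obtain ⟨q, hq⟩ := (even_f_odd k).two_dvd
  obtain ⟨t, rfl⟩ := Nat.exists_eq_add_of_le h1
  rw [hankelDet_eq_hankel_extSeq k]
  obtain ⟨a, hs, ha, hPhi⟩ := exists_stretch k _ (hgam i)
  -- The coordinates in the parallelogram are the height `t` above the bottom edge and the distance
  -- `d` from the right slanted edge.
  obtain ⟨d, hd⟩ : ∃ d, m + (f (2 * k + 1) + t) + d = gam k i :=
    ⟨gam k i - (m + (f (2 * k + 1) + t)), by omega⟩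
  refine ⟨fun hn => ?_, fun hn => ?_, fun hn hn' => ⟨?_, fun hne => ?_⟩⟩
  · rw [show t = f (2 * k) - 1 by omega, hs.hankel_top _ d (by omega) (by omega),
      show ((f (2 * k) : ℤ) - 1) / 2 = ((f (2 * k) - 1) / 2 : ℕ) by omega, sgn_natCast]
  · obtain rfl : t = 0 := by omega
    rw [add_zero, hs.hankel_bottom _ d (by omega) (by omega),
      show m + f (2 * k + 1) = gam k i - d by omega, hPhi d (by omega),
      show ((f (2 * k) + f (2 * k + 1) / 2 - d : ℕ) : ℤ) - (f (2 * k + 1) : ℤ) / 2 - 1 =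
        (f (2 * k) - 1 - d : ℕ) by omega, sgn_natCast]
    congr 1
    exact neg_one_pow_eq_of_even_add ⟨v, by omega⟩
  · rintro ⟨j, -, hj⟩
    -- The index `j` need not be the `i` found above; using the stretch at γ_j avoids proving that
    -- they agree.
    obtain ⟨b, hs', hb, -⟩ := exists_stretch k _ (hgam j)
    have hval : hankel (extSeq k) (m + f (2 * k)) (f (2 * k + 1) + t) =
        revSign t * ((-1) ^ (k + 1)) ^ t * f (2 * k) := by
      rcases hj with hj | hj
      · exact hs'.hankel_left _ t (by omega) (by omega)
      · exact hs'.hankel_right _ t (by omega) (by omega)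
    rw [hval, ← edge_sign k t (f (2 * k) - 1 - t) v (by omega),
      show ((f (2 * k) : ℤ) - 1) / 2 = (v : ℕ) by omega, sgn_natCast,
      show (f (2 * k + 2) : ℤ) - 1 - (f (2 * k + 1) + t : ℕ) = (f (2 * k) - 1 - t : ℕ) by omega,
      show (f (2 * k + 2) : ℤ) - 2 - (f (2 * k + 1) + t : ℕ) = (f (2 * k) - 1 - t : ℕ) - 1 by omega,
      sgn_half_mul_sub_one, ← Nat.cast_mul, sgn_natCast]
  · refine hs.hankel_interior _ t d (by omega) (by omega) ?_ ?_ (by omega)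
    · by_contra hc
      exact hne ⟨i, hi, Or.inr (by omega)⟩
    · by_contra hc
      exact hne ⟨i, hi, Or.inl (by omega)⟩
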